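/- Words are elements of the free monoid $\mathfrak A^*$ over a countably infinite alphabet $\mathfrak A$ containing pairwise distinct letters $a,b,t_1,t_2,\dots$; $\operatorname{var}\Sigma$ denotes the variety of all monoids satisfying the set of identities $\Sigma$. Put $\mathbf u_0=a^2b^2$, $\mathbf v_0=b^2a^2$, and, for $k\ge 0$, \[\mathbf u_{k+1}=c_k\,t_{k+1}\mathbf u_k,\qquad \mathbf v_{k+1}=c_k\,t_{k+1}\mathbf v_k,\qquad c_k=a \text{ if } k \text{ is even},\quad c_k=b \text{ if } k \text{ is odd}.\] Let $\mathbb E^1=\operatorname{var}\{xtx\approx xtx^2\approx x^2tx,\ xy^2x\approx x^2y^2\}$ and, for $n\ge1$, $\mathbb E^1\{\sigma_n\}=\operatorname{var}\{xtx\approx xtx^2\approx x^2tx,\ xy^2x\approx x^2y^2,\ \mathbf u_n\approx\mathbf v_n\}$. Let $\beta$ be the fully invariant congruence of $\mathbb E^1$ on $\mathfrak A^*$, that is, $\mathbf u\mathrel\beta\mathbf v$ iff $\mathbb E^1$ satisfies $\mathbf u\approx\mathbf v$, and let $[\mathbf w]_\beta$ be the $\beta$-class of $\mathbf w$. For a union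 $W\subseteq\mathfrak A^*$ of $\beta$-classes let $I_W\subseteq\mathfrak A^*/\beta$ be the ideal of all classes $\mathtt c$ such that no class of a word of $W$ has the form $\mathtt p\,\mathtt c\,\mathtt s$ with $\mathtt p,\mathtt s\in\mathfrak A^*/\beta$; let $M_\beta(W)$ be the Rees quotient of $\mathfrak A^*/\beta$ over $I_W$ (and $\mathfrak A^*/\beta$ itself if $I_W=\varnothing$), and let $\mathbb M_\beta(W)$ be the monoid variety generated by $M_\beta(W)$. A set $W$ of words is stable with respect to a monoid variety $\mathbb V$ if $\mathbf v\in W$ whenever $\mathbf u\in W$ and $\mathbb V$ satisfies $\mathbf u\approx\mathbf v$. Then for each $n\ge1$: (i) $\mathbb E^1\{\sigma_{n+1}\}=\mathbb M_\beta([\mathbf v_n]_\beta)$; in particular, $\mathbb E^1\{\sigma_2\}=\mathbb M_\beta([at_1b^2a]_\beta)$; (ii) a monoid variety $\mathbb V$ contains $\mathbb E^1\{\sigma_{n+1}\}$ if and only if the $\beta$-class $[\mathbf v_n]_\beta$ is stable with respect to $\mathbb V$. -/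

import Mathlib

universe u

namespace MonVar

/-- Words over the countably infinite alphabet `ℕ`. -/
abbrev Word : Type := FreeMonoid ℕ

/-- The monoid `M` satisfies the identity `p ≈ q`: every substitution of elements of `M` for the
letters makes the two sides equal. -/
def Satisfies (M : Type u) [Monoid M] (p q : Word) : Prop :=
  ∀ f : ℕ → M, FreeMonoid.lift f p = FreeMonoid.lift f q

/-- A monoid variety: a class of monoids that is the class of all models of some set of
identities. -/
@[ext]
structure MonoidVariety where
  /-- the monoids that belong to the variety -/
  Mem : (M : Type u) → [Monoid M] → Prop
  /-- the class is defined by a set of identities -/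
  equational : ∃ S : Set (Word × Word), ∀ (M : Type u) [Monoid M],
    Mem M ↔ ∀ p ∈ S, Satisfies M p.1 p.2

namespace MonoidVariety

/-- `V ≤ V'`: the variety `V` is contained in the variety `V'`. -/
instance : LE MonoidVariety.{u} where
  le V V' := ∀ (M : Type u) [Monoid M], V.Mem M → V'.Mem M

/-- `var S`: the variety defined by the set of identities `S`. -/
def var (S : Set (Word × Word)) : MonoidVariety.{u} where
  Mem M _ := ∀ p ∈ S, Satisfies M p.1 p.2
  equational := ⟨S, fun _ _ => Iff.rfl⟩

/-- The variety generated by the monoid `M`: the intersection of all varieties containing `M`. -/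
def generatedBy (M : Type u) [Monoid M] : MonoidVariety.{u} where
  Mem N _ := ∀ V : MonoidVariety.{u}, V.Mem M → V.Mem N
  equational := by
    refine ⟨{p | Satisfies M p.1 p.2}, fun N _ => ⟨fun h => ?_, fun h V hV => ?_⟩⟩
    · exact h (var {p | Satisfies M p.1 p.2}) (fun p hp => hp)
    · obtain ⟨S, hS⟩ := V.equational
      exact (hS N).2 fun p hp => h p ((hS M).1 hV p hp)

/-- The variety `V` satisfies the identity `p ≈ q`. -/
def Models (V : MonoidVariety.{u}) (p q : Word) : Prop :=
  ∀ (M : Type u) [Monoid M], V.Mem M → Satisfies M p q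

/-- The fully invariant congruence of `V` on the free monoid of words. -/
def congruence (V : MonoidVariety.{u}) : Con Word where
  r p q := V.Models p q
  iseqv :=
    { refl := fun _ _ _ _ _ => rfl
      symm := fun h M _ hM f => (h M hM f).symm
      trans := fun h h' M _ hM f => (h M hM f).trans (h' M hM f) }
  mul' := fun h h' M _ hM f => by
    rw [map_mul, map_mul, h M hM f, h' M hM f]

/-- The set of words `W` is stable with respect to `V`. -/
def Stable (V : MonoidVariety.{u}) (W : Set Word) : Prop :=
  ∀ p ∈ W, ∀ q : Word, V.Models p q → q ∈ W

end MonoidVariety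

/-- The Rees congruence of a two-sided ideal `I` (possibly empty) of a monoid `Q`: the elements
of `I` are identified with each other, and no others. -/
def reesCon {Q : Type u} [Monoid Q] (I : Set Q)
    (hl : ∀ q : Q, ∀ i ∈ I, q * i ∈ I) (hr : ∀ i ∈ I, ∀ q : Q, i * q ∈ I) : Con Q where
  r x y := x = y ∨ (x ∈ I ∧ y ∈ I)
  iseqv :=
    { refl := fun _ => Or.inl rfl
      symm := fun h => h.elim (fun e => Or.inl e.symm) (fun e => Or.inr ⟨e.2, e.1⟩)
      trans := by
        rintro x y z (rfl | ⟨hx, hy⟩) (rfl | ⟨hy', hz⟩)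
        · exact Or.inl rfl
        · exact Or.inr ⟨hy', hz⟩
        · exact Or.inr ⟨hx, hy⟩
        · exact Or.inr ⟨hx, hz⟩ }
  mul' := by
    rintro w x y z (rfl | ⟨hw, hx⟩) (rfl | ⟨hy, hz⟩)
    · exact Or.inl rfl
    · exact Or.inr ⟨hl _ _ hy, hl _ _ hz⟩
    · exact Or.inr ⟨hr _ hw _, hr _ hx _⟩
    · exact Or.inr ⟨hr _ hw _, hr _ hx _⟩

/-- The `τ`-classes that are not below (in the extended subword quasi-order: `c ≤ d` iff
`d = p * c * s` for some classes `p`, `s`) the class of any word of `W`. -/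
def outside (τ : Con Word) (W : Set Word) : Set τ.Quotient :=
  {c | ¬ ∃ w ∈ W, ∃ p s : τ.Quotient, (w : τ.Quotient) = p * c * s}

/-- The congruence on the quotient by `τ` collapsing the classes outside the closure of `W`. -/
def MWCon (τ : Con Word) (W : Set Word) : Con τ.Quotient :=
  reesCon (outside τ W)
    (fun q i hi ⟨w, hw, p, s, h⟩ => hi ⟨w, hw, p * q, s, by rw [h]; simp only [mul_assoc]⟩)
    (fun i hi q ⟨w, hw, p, s, h⟩ => hi ⟨w, hw, p, q * s, by rw [h]; simp only [mul_assoc]⟩)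

/-- The monoid `M_τ(W)`, for `W` a union of `τ`-classes: the Rees quotient of the quotient of the
free monoid by `τ` over the ideal of classes outside the closure of `W`. If that ideal is empty,
nothing is collapsed and this is the quotient by `τ` itself. -/
abbrev MW (τ : Con Word) (W : Set Word) : Type := (MWCon τ W).Quotient

/-- The variety generated by `M_τ(W)`, as a class of monoids in an arbitrary universe. -/
def varMW (τ : Con Word) (W : Set Word) : MonoidVariety.{u} :=
  MonoidVariety.generatedBy (ULift.{u} (MW τ W))

/-- the letter `a` -/
def a : Word := FreeMonoid.of 0

/-- the letter `b` -/
def b : Word := FreeMonoid.of 1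

/-- the letters `t₁, t₂, …`, different from `a` and `b` -/
def t (k : ℕ) : Word := FreeMonoid.of (k + 2)

/-- `u₀ = a²b²`; `uₖ₊₁ = a tₖ₊₁ uₖ` for even `k` and `uₖ₊₁ = b tₖ₊₁ uₖ` for odd `k`. -/
def uWord : ℕ → Word
  | 0 => a ^ 2 * b ^ 2
  | k + 1 => (if Even k then a else b) * t (k + 1) * uWord k

/-- `v₀ = b²a²`; `vₖ₊₁ = a tₖ₊₁ vₖ` for even `k` and `vₖ₊₁ = b tₖ₊₁ vₖ` for odd `k`. -/
def vWord : ℕ → Word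
  | 0 => b ^ 2 * a ^ 2
  | k + 1 => (if Even k then a else b) * t (k + 1) * vWord k

/-- The identities `xtx ≈ xtx²`, `xtx² ≈ x²tx`, `xy²x ≈ x²y²`, written with the letters
`x = a`, `y = b`, `t = t₁`. -/
def E1Identities : Set (Word × Word) :=
  {(a * t 1 * a, a * t 1 * a ^ 2), (a * t 1 * a ^ 2, a ^ 2 * t 1 * a),
    (a * b ^ 2 * a, a ^ 2 * b ^ 2)}

/-- The variety `𝔼¹ = var {xtx ≈ xtx² ≈ x²tx, xy²x ≈ x²y²}`. -/
def E1 : MonoidVariety.{u} := MonoidVariety.var E1Identities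

/-- The variety `𝔼¹{σₙ} = var {xtx ≈ xtx² ≈ x²tx, xy²x ≈ x²y², uₙ ≈ vₙ}`. -/
def E1sigma (n : ℕ) : MonoidVariety.{u} :=
  MonoidVariety.var (E1Identities ∪ {(uWord n, vWord n)})

/-- `β`: the fully invariant congruence of `𝔼¹`. -/
def beta : Con Word := MonoidVariety.congruence E1.{0}

/-- The `β`-class of a word. -/
def betaClass (w : Word) : Set Word := {w' | beta w w'}

end MonVar

/-!
For `n ≥ 1` the class `[v_n]` is a language recognised by an automaton (`vLanguage`), and membership
in it is not affected by the identities of `𝔼¹`. Call two words substitution equivalent if after any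
substitution they are interchangeable in every context of `[v_n]`. Identities of `M_β([v_n])`, and
identities of a variety for which `[v_n]` is stable, have substitution equivalent sides. Hence both
statements follow once `𝔼¹{σ_{n+1}}` is seen to contain `M_β([v_n])` and to satisfy every identity
with substitution equivalent sides.

Membership of `M_β([v_n])` holds because `v_n` has too few alternations between `a` and `b` to
contain a nontrivial instance of `σ_{n+1}`. Conversely, let the sides of an identity be substitution
equivalent. Substitutions into `[v_n]` detect which letters are multiple, in which order the simple
letters occur, and which letters occur between two given simple ones. Inside a block, the factor
between two neighbouring simple letters, `𝔼¹` leaves only the order of the first occurrences of the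
letters to be adjusted. Adjacent occurrences of `x` and `y` can be exchanged by `σ_{n+1}` if an
earlier block contains both letters or if the earlier blocks contain them alternately at least
`n + 1` times; otherwise the substitution that maps these blocks onto the common prefix of `u_d` and
`v_d`, where `d ≤ n` is the number of alternations, shows that `x` and `y` come in the same order on
both sides.
-/

namespace MonVar

open FreeMonoid (ofList toList)

/-! ### Words and identities -/

/-- The value in a monoid of a word, written as a list of letters, when `g` gives the values of
the letters. -/
def eval {α : Type*} {N : Type*} [Monoid N] (g : α → N) (w : List α) : N := (w.map g).prod

section Eval

variable {α N : Type*} [Monoid N] (g : α → N)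

@[simp]
theorem eval_nil : eval g [] = 1 := rfl

@[simp]
theorem eval_cons (x : α) (w : List α) : eval g (x :: w) = g x * eval g w := List.prod_cons

@[simp]
theorem eval_append (v w : List α) : eval g (v ++ w) = eval g v * eval g w := by
  rw [eval, List.map_append, List.prod_append, eval, eval]

theorem lift_eq_eval (w : FreeMonoid α) : FreeMonoid.lift g w = eval g w.toList :=
  FreeMonoid.lift_apply g w

theorem lift_ofList_flatMap {β : Type*} (φ : β → List α) (w : FreeMonoid β) :
    FreeMonoid.lift (fun x => ofList (φ x)) w = ofList (w.toList.flatMap φ) := by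
  induction w using FreeMonoid.recOn with
  | one => rfl
  | of_mul x w ih => rw [map_mul, ih, FreeMonoid.lift_eval_of]; rfl

end Eval

/-- The lists `U` and `V` are substitution equivalent with respect to the language `L`: after any
substitution of lists for the letters they can replace each other in every context of `L`. -/
def SubstEquiv (L : Set (List ℕ)) (U V : List ℕ) : Prop :=
  ∀ (φ : ℕ → List ℕ) (P S : List ℕ), P ++ U.flatMap φ ++ S ∈ L ↔ P ++ V.flatMap φ ++ S ∈ L

namespace SubstEquiv

variable {L : Set (List ℕ)} {U V : List ℕ}

theorem symm (h : SubstEquiv L U V) : SubstEquiv L V U := fun φ P S => (h φ P S).symm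

theorem trans {X : List ℕ} (h : SubstEquiv L U V) (h' : SubstEquiv L V X) : SubstEquiv L U X :=
  fun φ P S => (h φ P S).trans (h' φ P S)

theorem append_append (h : SubstEquiv L U V) (A B : List ℕ) :
    SubstEquiv L (A ++ U ++ B) (A ++ V ++ B) := fun φ P S => by
  simpa only [List.flatMap_append, List.append_assoc] using
    h φ (P ++ A.flatMap φ) (B.flatMap φ ++ S)

theorem mem_iff (h : SubstEquiv L U V) : U ∈ L ↔ V ∈ L := by
  simpa only [List.flatMap_singleton', List.nil_append, List.append_nil] using
    h (fun x => [x]) [] []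

end SubstEquiv

section Satisfies

variable {M N : Type*} [Monoid M] [Monoid N] {p q : Word}

theorem Satisfies.symm (h : Satisfies M p q) : Satisfies M q p := fun f => (h f).symm

theorem Satisfies.of_injective (φ : M →* N) (hφ : Function.Injective φ) (h : Satisfies N p q) :
    Satisfies M p q := fun f => hφ <| by
  rw [FreeMonoid.hom_map_lift, FreeMonoid.hom_map_lift]; exact h _

theorem satisfies_ulift_iff : Satisfies (ULift.{u} M) p q ↔ Satisfies M p q :=
  ⟨.of_injective (MulEquiv.ulift (α := M)).symm.toMonoidHom MulEquiv.ulift.symm.injective,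
    .of_injective (MulEquiv.ulift (α := M)).toMonoidHom MulEquiv.ulift.injective⟩

end Satisfies

namespace MonoidVariety

variable {V W : MonoidVariety.{u}}

theorem mem_iff_models {M : Type u} [Monoid M] :
    V.Mem M ↔ ∀ p q, V.Models p q → Satisfies M p q := by
  refine ⟨fun hM p q h => h M hM, fun h => ?_⟩
  obtain ⟨S, hS⟩ := V.equational
  exact (hS M).2 fun p hp => h p.1 p.2 fun N _ hN => (hS N).1 hN p hp

theorem Models.symm {p q : Word} (h : V.Models p q) : V.Models q p := fun M _ hM => (h M hM).symm

theorem Models.subst {p q : Word} (h : V.Models p q) (φ : ℕ → Word) :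
    V.Models (FreeMonoid.lift φ p) (FreeMonoid.lift φ q) := fun M _ hM f => by
  rw [FreeMonoid.hom_map_lift, FreeMonoid.hom_map_lift]; exact h M hM _

theorem eq_generatedBy {M : Type u} [Monoid M] (hM : V.Mem M)
    (h : ∀ p q, Satisfies M p q → V.Models p q) : V = generatedBy M := by
  ext N _
  exact ⟨fun hN W hW => mem_iff_models.2 fun p q hpq => h p q (hpq M hW) N hN,
    fun hN => hN V hM⟩

theorem Models.substEquiv {Z : Set Word} (hZ : V.Stable Z) {p q : Word} (h : V.Models p q) :
    SubstEquiv (ofList ⁻¹' Z) p.toList q.toList := by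
  have replace_mem : ∀ {p q : Word}, V.Models p q → ∀ (φ : ℕ → List ℕ) (P S : List ℕ),
      ofList (P ++ p.toList.flatMap φ ++ S) ∈ Z → ofList (P ++ q.toList.flatMap φ ++ S) ∈ Z := by
    intro p q h φ P S hp
    refine hZ _ hp _ ?_
    have := h.subst fun x => ofList (φ x)
    rw [lift_ofList_flatMap, lift_ofList_flatMap] at this
    exact V.congruence.mul (V.congruence.mul (V.congruence.refl (ofList P)) this)
      (V.congruence.refl (ofList S))
  exact fun φ P S => ⟨replace_mem h φ P S, replace_mem h.symm φ P S⟩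

end MonoidVariety

section MW

variable {τ : Con Word} {W : Set Word}

theorem satisfies_MW_iff {p q : Word} :
    Satisfies (MW τ W) p q ↔ ∀ φ : ℕ → Word,
      τ (FreeMonoid.lift φ p) (FreeMonoid.lift φ q) ∨
        (FreeMonoid.lift φ p : τ.Quotient) ∈ outside τ W ∧
          (FreeMonoid.lift φ q : τ.Quotient) ∈ outside τ W := by
  let π : Word →* MW τ W := (MWCon τ W).mk'.comp τ.mk'
  have hπ : Function.Surjective π := (MWCon τ W).mk'_surjective.comp τ.mk'_surjective
  have eq_iff (x y : Word) : π x = π y ↔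
      τ x y ∨ (x : τ.Quotient) ∈ outside τ W ∧ (y : τ.Quotient) ∈ outside τ W := by
    rw [← Con.eq τ]; exact Con.eq _
  simp only [← eq_iff, FreeMonoid.hom_map_lift]
  exact ⟨fun h φ => h _, fun h f => by
    obtain ⟨φ, rfl⟩ := hπ.comp_left f
    exact h φ⟩

variable (hW : ∀ ⦃x y⦄, τ x y → x ∈ W → y ∈ W)
include hW

theorem notMem_outside_iff {x : Word} :
    (x : τ.Quotient) ∉ outside τ W ↔ ∃ P S, P * x * S ∈ W := by
  simp only [outside, Set.mem_ofPred_eq, not_not]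
  refine ⟨?_, fun ⟨P, S, h⟩ => ⟨_, h, P, S, rfl⟩⟩
  rintro ⟨w, hw, p, s, h⟩
  induction p using Con.induction_on with | _ P
  induction s using Con.induction_on with | _ S
  rw [← Con.coe_mul, ← Con.coe_mul, Con.eq] at h
  exact ⟨P, S, hW h hw⟩

theorem Satisfies.substEquiv {p q : Word} (h : Satisfies (MW τ W) p q) :
    SubstEquiv (ofList ⁻¹' W) p.toList q.toList := by
  have replace_mem : ∀ {p q : Word}, Satisfies (MW τ W) p q →
      ∀ (φ : ℕ → List ℕ) (P S : List ℕ),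
      ofList (P ++ p.toList.flatMap φ ++ S) ∈ W → ofList (P ++ q.toList.flatMap φ ++ S) ∈ W := by
    intro p q h φ P S hp
    have := satisfies_MW_iff.1 h fun x => ofList (φ x)
    rw [lift_ofList_flatMap, lift_ofList_flatMap] at this
    obtain hτ | ⟨hout, -⟩ := this
    · exact hW (τ.mul (τ.mul (τ.refl (ofList P)) hτ) (τ.refl (ofList S))) hp
    · exact absurd hout ((notMem_outside_iff hW).2 ⟨ofList P, ofList S, hp⟩)
  exact fun φ P S => ⟨replace_mem h φ P S, replace_mem h.symm φ P S⟩

theorem MonoidVariety.stable_of_mem_MW {V : MonoidVariety.{u}} (h : V.Mem (ULift.{u} (MW τ W))) :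
    V.Stable W := fun _ hp _ hpq =>
  (Satisfies.substEquiv hW (satisfies_ulift_iff.1 (hpq _ h))).mem_iff.1 hp

end MW

/-! ### The variety `𝔼¹` -/

/-- The three identities defining `𝔼¹`, for the elements of a monoid `N`. -/
structure IsE1 (N : Type*) [Monoid N] : Prop where
  mul_mul_self (x s : N) : x * s * x = x * s * x ^ 2
  mul_mul_sq (x s : N) : x * s * x ^ 2 = x ^ 2 * s * x
  sandwich (x y : N) : x * y ^ 2 * x = x ^ 2 * y ^ 2

theorem forall_apply_apply_iff {N : Type*} {i j : ℕ} (hij : j ≠ i) {P : N → N → Prop} :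
    (∀ f : ℕ → N, P (f i) (f j)) ↔ ∀ x y, P x y :=
  ⟨fun h x y => by simpa only [if_true, if_neg hij] using h fun k => if k = i then x else y,
    fun h f => h (f i) (f j)⟩

theorem mem_E1_iff {N : Type u} [Monoid N] : E1.{u}.Mem N ↔ IsE1 N := by
  have h30 : 3 ≠ 0 := by decide
  have h1 := forall_apply_apply_iff h30 (P := fun x s : N => x * s * x = x * s * x ^ 2)
  have h2 := forall_apply_apply_iff h30 (P := fun x s : N => x * s * x ^ 2 = x ^ 2 * s * x)
  have h3 := forall_apply_apply_iff one_ne_zero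
    (P := fun x y : N => x * y ^ 2 * x = x ^ 2 * y ^ 2)
  simp only [E1, MonoidVariety.var, E1Identities, Set.forall_mem_insert, Set.mem_singleton_iff,
    forall_eq, Satisfies, map_mul, map_pow, a, b, t, FreeMonoid.lift_eval_of, Nat.reduceAdd,
    h1, h2, h3]
  exact ⟨fun h => ⟨h.1, h.2.1, h.2.2⟩, fun h => ⟨h.1, h.2, h.3⟩⟩

theorem mem_E1sigma_iff {n : ℕ} {N : Type u} [Monoid N] :
    (E1sigma.{u} n).Mem N ↔ IsE1 N ∧ Satisfies N (uWord n) (vWord n) := by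
  rw [← mem_E1_iff]
  simp only [E1sigma, E1, MonoidVariety.var, Set.union_singleton, Set.forall_mem_insert]
  exact and_comm

namespace IsE1

variable {N : Type*} [Monoid N] (hN : IsE1 N)
include hN

theorem sq_mul_mul (x s : N) : x ^ 2 * s * x = x * s * x :=
  ((hN.mul_mul_self x s).trans (hN.mul_mul_sq x s)).symm

theorem sq_mul_self (x : N) : x ^ 2 * x = x ^ 2 := by
  simpa only [mul_one, pow_two] using hN.sq_mul_mul x 1

variable {α : Type*} (g : α → N) {A B D : List α}

theorem sq_mul_eval_sq_mul (x : α) (M : List α) :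
    g x ^ 2 * eval (g ^ 2) M * g x = g x ^ 2 * eval (g ^ 2) M := by
  induction M using List.reverseRecOn with
  | nil => simpa only [eval_nil, mul_one] using hN.sq_mul_self (g x)
  | append_singleton M y ih =>
    set m := g x ^ 2 * eval (g ^ 2) M
    have hm : g x ^ 2 * eval (g ^ 2) (M ++ [y]) = m * g y ^ 2 := by
      simp only [eval_append, eval_cons, eval_nil, mul_one, Pi.pow_apply, m, mul_assoc]
    calc g x ^ 2 * eval (g ^ 2) (M ++ [y]) * g x
        = m * g x * g y ^ 2 * g x := by rw [hm, ih]
      _ = m * (g x * g y ^ 2 * g x) := by simp only [mul_assoc]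
      _ = m * g x * g x * g y ^ 2 := by rw [hN.sandwich, pow_two (g x)]; simp only [mul_assoc]
      _ = g x ^ 2 * eval (g ^ 2) (M ++ [y]) := by rw [ih, ih, hm]

theorem eval_sq_mul_eval {C : List α} (hC : C ⊆ D) :
    eval (g ^ 2) D * eval g C = eval (g ^ 2) D := by
  induction C with
  | nil => rw [eval_nil, mul_one]
  | cons x C ih =>
    obtain ⟨hx, hC⟩ := List.cons_subset.1 hC
    suffices eval (g ^ 2) D * g x = eval (g ^ 2) D by rw [eval_cons, ← mul_assoc, this, ih hC]
    obtain ⟨D₁, D₂, rfl⟩ := List.append_of_mem hx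
    rw [eval_append, eval_cons, mul_assoc, Pi.pow_apply, hN.sq_mul_eval_sq_mul]

variable [DecidableEq α]

theorem eval_duplicate {x : α} (hx : 2 ≤ (A ++ x :: B).count x) :
    eval g (A ++ x :: x :: B) = eval g (A ++ x :: B) := by
  have hAB : x ∈ A ∨ x ∈ B := by
    by_contra! hAB
    simp [List.count_eq_zero_of_not_mem hAB.1, List.count_eq_zero_of_not_mem hAB.2] at hx
  obtain hA | hB := hAB
  · obtain ⟨A₁, A₂, rfl⟩ := List.append_of_mem hA
    simpa only [eval_append, eval_cons, pow_two, mul_assoc] using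
      congr_arg (eval g A₁ * · * eval g B) (hN.mul_mul_self (g x) (eval g A₂)).symm
  · obtain ⟨B₁, B₂, rfl⟩ := List.append_of_mem hB
    simpa only [eval_append, eval_cons, pow_two, mul_assoc] using
      congr_arg (eval g A * · * eval g B₂) (hN.sq_mul_mul (g x) (eval g B₁))

theorem eval_eq_mul_eval_sq_mul (hD : ∀ d ∈ D, 2 ≤ (A ++ D ++ B).count d) :
    eval g (A ++ D ++ B) = eval g A * eval (g ^ 2) D * eval g B := by
  induction D generalizing A with
  | nil => simp only [List.append_nil, eval_append, eval_nil, mul_one]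
  | cons x D ih =>
    simp only [List.forall_mem_cons, List.append_assoc, List.cons_append] at hD
    have hdup := hN.eval_duplicate g hD.1
    have hsq := ih (A := A ++ [x, x]) fun d hd => (hD.2 d hd).trans <| by
      simp only [List.count_append, List.count_cons, List.count_nil]; omega
    simp only [List.append_assoc, List.cons_append, List.nil_append] at hsq ⊢
    rw [← hdup, hsq]
    simp only [eval_append, eval_cons, eval_nil, mul_one, Pi.pow_apply, pow_two (g x), mul_assoc]

/-- Inside a block of multiple letters only the order of the first occurrences matters. -/
theorem eval_absorb {C : List α} (hC : C ⊆ D) (hD : ∀ d ∈ D, 2 ≤ (A ++ D ++ B).count d) :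
    eval g (A ++ D ++ C ++ B) = eval g (A ++ D ++ B) := by
  have hD' : ∀ d ∈ D, 2 ≤ (A ++ D ++ (C ++ B)).count d := fun d hd => (hD d hd).trans <| by
    simp only [List.count_append]; omega
  rw [List.append_assoc (A ++ D), hN.eval_eq_mul_eval_sq_mul g hD', eval_append,
    hN.eval_eq_mul_eval_sq_mul g hD, mul_assoc (eval g A), ← mul_assoc (eval (g ^ 2) D),
    hN.eval_sq_mul_eval g hC, mul_assoc]

end IsE1

/-! ### The language of `v_n` -/

/-- The letter `c_k ∈ {a, b}`, which precedes `t_{k+1}` in `u_{k+1}` and `v_{k+1}`. -/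
def blockLetter (k : ℕ) : ℕ := if Even k then 0 else 1

/-- The prefix `c_{k-1} t_k ⋯ c_0 t_1` shared by `u_k` and `v_k`; the letter `t_j` is `j + 2`. -/
def commonPrefix : ℕ → List ℕ
  | 0 => []
  | k + 1 => blockLetter k :: (k + 3) :: commonPrefix k

theorem blockLetter_le_one (k : ℕ) : blockLetter k ≤ 1 := by
  unfold blockLetter; split <;> simp only [zero_le, le_refl]

theorem blockLetter_ne (k j : ℕ) : blockLetter k ≠ j + 3 := by
  have := blockLetter_le_one k; omega

@[simp]
theorem blockLetter_zero : blockLetter 0 = 0 := rfl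

theorem blockLetter_add_two (k : ℕ) : blockLetter (k + 2) = blockLetter k := by
  simp only [blockLetter, Nat.even_add_one, not_not]

theorem blockLetter_eq_and_succ_eq (k : ℕ) :
    blockLetter k = 0 ∧ blockLetter (k + 1) = 1 ∨ blockLetter k = 1 ∧ blockLetter (k + 1) = 0 := by
  by_cases hk : Even k <;> simp [blockLetter, hk, Nat.even_add_one]

theorem commonPrefix_succ_eq_append (k : ℕ) : ∃ H, commonPrefix (k + 1) = H ++ [0, 3] := by
  induction k with
  | zero => exact ⟨[], rfl⟩
  | succ k ih =>
    obtain ⟨H, hH⟩ := ih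
    exact ⟨blockLetter (k + 1) :: (k + 1 + 3) :: H, by rw [commonPrefix, hH]; rfl⟩

theorem lt_of_mem_commonPrefix {k l : ℕ} (h : l ∈ commonPrefix k) : l < k + 3 := by
  induction k with
  | zero => exact absurd h List.not_mem_nil
  | succ k ih =>
    have := blockLetter_le_one k
    obtain rfl | rfl | h := List.mem_cons.1 h |>.imp_right List.mem_cons.1
    · omega
    · omega
    · have := ih h
      omega

theorem toList_ite_even (k : ℕ) : (if Even k then a else b).toList = [blockLetter k] := by
  unfold blockLetter; split <;> rfl

theorem toList_uWord (k : ℕ) : (uWord k).toList = commonPrefix k ++ [0, 0, 1, 1] := by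
  induction k with
  | zero => rfl
  | succ k ih =>
    rw [uWord, FreeMonoid.toList_mul, FreeMonoid.toList_mul, toList_ite_even, ih]; rfl

theorem toList_vWord (k : ℕ) : (vWord k).toList = commonPrefix k ++ [1, 1, 0, 0] := by
  induction k with
  | zero => rfl
  | succ k ih =>
    rw [vWord, FreeMonoid.toList_mul, FreeMonoid.toList_mul, toList_ite_even, ih]; rfl

/-- The states of the automaton reading the words of the class of `v_n`. In `block k seen` the next
letter `t` is `t_{k+1}` and `seen` tells whether `c_k` has been read; `last`, `lastB` and `done`
belong to the part after `t_1`: nothing, only `b`, or both letters have been read there. -/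
inductive State
  | dead
  | block (k : ℕ) (seen : Bool)
  | last
  | lastB
  | done

namespace State

/-- The state from which the words of the class of `v_n` are read. -/
def start : ℕ → State
  | 0 => last
  | k + 1 => block k false

/-- The transition function of the automaton. -/
def step : State → ℕ → State
  | dead, _ => dead
  | block k seen, l =>
    if l = blockLetter k then block k true
    else if l = k + 3 ∧ seen = true then start k
    else dead
  | last, l => if l = 1 then lastB else dead
  | lastB, l => if l = 1 then lastB else if l = 0 then done else dead
  | done, l => if l ≤ 1 then done else dead

/-- The state reached from `q` by reading `w`. -/
def run (q : State) (w : List ℕ) : State := w.foldl step q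

/-- The number of letters `t_j` that remain to be read. -/
def level : State → ℕ
  | block k _ => k + 1
  | _ => 0

@[simp]
theorem run_nil (q : State) : run q [] = q := rfl

@[simp]
theorem run_cons (q : State) (l : ℕ) (w : List ℕ) : run q (l :: w) = run (step q l) w := rfl

@[simp]
theorem run_append (q : State) (v w : List ℕ) : run q (v ++ w) = run (run q v) w :=
  List.foldl_append

@[simp]
theorem run_dead (w : List ℕ) : run dead w = dead := by
  induction w with
  | nil => rfl
  | cons _ _ ih => exact ih

@[simp]
theorem level_start (k : ℕ) : level (start k) = k := by cases k <;> rfl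

theorem step_block_blockLetter (k : ℕ) (seen : Bool) :
    step (block k seen) (blockLetter k) = block k true := if_pos rfl

theorem step_block_true (k : ℕ) : step (block k true) (k + 3) = start k := by
  rw [step, if_neg (blockLetter_ne k k).symm, if_pos ⟨rfl, rfl⟩]

theorem run_block_replicate (k : ℕ) (seen : Bool) {j : ℕ} (hj : j ≠ 0) :
    run (block k seen) (List.replicate j (blockLetter k)) = block k true := by
  induction j generalizing seen with
  | zero => exact absurd rfl hj
  | succ j ih =>
    rw [List.replicate_succ, run_cons, step_block_blockLetter]
    obtain rfl | hj := eq_or_ne j 0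
    · rfl
    · exact ih true hj

theorem run_commonPrefix (k : ℕ) : run (start k) (commonPrefix k) = last := by
  induction k with
  | zero => rfl
  | succ k ih =>
    rw [commonPrefix, run_cons, run_cons, start, step_block_blockLetter, step_block_true, ih]

theorem exists_run_start_eq {n e : ℕ} (h : e ≤ n) : ∃ L, run (start n) L = start e := by
  induction n, h using Nat.le_induction with
  | base => exact ⟨[], rfl⟩
  | succ n _ ih =>
    obtain ⟨L, hL⟩ := ih
    exact ⟨blockLetter n :: (n + 3) :: L, by
      rw [run_cons, run_cons, start, step_block_blockLetter, step_block_true, hL]⟩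

section Absorption

variable {c d : ℕ}

theorem step_step_self (q : State) (hc : c ≤ 1) : step (step q c) c = step q c := by
  cases q with
  | dead => rfl
  | block k seen =>
    by_cases h : c = blockLetter k
    · rw [h, step_block_blockLetter, step_block_blockLetter]
    · rw [step, if_neg h, if_neg (by omega)]; rfl
  | last => interval_cases c <;> rfl
  | lastB => interval_cases c <;> rfl
  | done => interval_cases c <;> rfl

theorem step_step_of_step_eq {q : State} (hd : d ≤ 1) (h : step q c = q) :
    step (step q d) c = step q d := by
  cases q with
  | dead => rfl
  | block k seen =>
    by_cases hdk : d = blockLetter k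
    · by_cases hck : c = blockLetter k
      · rw [hdk, hck, step_block_blockLetter, step_block_blockLetter]
      · rw [step, if_neg hck] at h
        split at h <;> rename_i hk
        · have := congr_arg level h
          rw [level_start] at this
          exact absurd this (Nat.succ_ne_self k).symm
        · cases h
    · rw [step, if_neg hdk, if_neg (by omega)]; rfl
  | last => rw [step] at h; split at h <;> cases h
  | lastB =>
    have hc : c = 1 := by
      by_contra hc
      rw [step, if_neg hc] at h
      split at h <;> cases h
    interval_cases d <;> subst hc <;> rfl
  | done => interval_cases d <;> exact h

theorem step_run_of_mem (q : State) {D : List ℕ} (hD : ∀ d ∈ D, d ≤ 1) (hc : c ∈ D) :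
    step (run q D) c = run q D := by
  induction D using List.reverseRecOn with
  | nil => exact absurd hc List.not_mem_nil
  | append_singleton D d ih =>
    rw [run_append, run_cons, run_nil]
    have hd : d ≤ 1 := hD d (by simp only [List.mem_append, List.mem_singleton, or_true])
    obtain hc | hc := List.mem_append.1 hc
    · exact step_step_of_step_eq hd (ih (fun e he => hD e (List.mem_append_left _ he)) hc)
    · rw [List.mem_singleton.1 hc]; exact step_step_self _ hd

theorem run_append_of_subset (q : State) {C D : List ℕ} (hD : ∀ d ∈ D, d ≤ 1) (hC : C ⊆ D) :
    run q (D ++ C) = run q D := by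
  induction C with
  | nil => rw [List.append_nil]
  | cons c C ih =>
    obtain ⟨hc, hC⟩ := List.cons_subset.1 hC
    rw [run_append, run_cons, step_run_of_mem q hD hc, ← run_append, ih hC]

end Absorption

section Accepted

variable {w : List ℕ}

theorem run_done_iff : run done w = done ↔ ∀ l ∈ w, l ≤ 1 := by
  induction w with
  | nil => simp
  | cons l w ih =>
    by_cases hl : l ≤ 1 <;> simp [step, hl, ih]

theorem run_lastB_iff : run lastB w = done ↔ (∀ l ∈ w, l ≤ 1) ∧ 0 ∈ w := by
  induction w with
  | nil => simp
  | cons l w ih =>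
    obtain rfl | rfl | hl : l = 0 ∨ l = 1 ∨ 2 ≤ l := by omega
    · simp [step, run_done_iff]
    · simp [step, ih]
    · simp [step, show l ≠ 1 by omega, show l ≠ 0 by omega, show ¬ l ≤ 1 by omega]

theorem run_last_iff : run last w = done ↔ ∃ w', w = 1 :: w' ∧ (∀ l ∈ w', l ≤ 1) ∧ 0 ∈ w' := by
  cases w with
  | nil => simp
  | cons l w =>
    by_cases hl : l = 1 <;> simp [step, hl, run_lastB_iff]

theorem exists_eq_of_run_block {k : ℕ} {seen : Bool} (h : run (block k seen) w = done) :
    ∃ j w', w = List.replicate j (blockLetter k) ++ (k + 3) :: w' ∧ (seen = false → j ≠ 0) ∧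
      run (start k) w' = done := by
  induction w generalizing seen with
  | nil => cases h
  | cons l w ih =>
    rw [run_cons, step] at h
    split_ifs at h with hl ht
    · obtain ⟨j, w', rfl, -, hw'⟩ := ih h
      exact ⟨j + 1, w', by rw [hl]; rfl, fun _ => j.succ_ne_zero, hw'⟩
    · exact ⟨0, w, by rw [ht.1]; rfl, by simp [ht.2], h⟩
    · rw [run_dead] at h; cases h

theorem mem_of_run_start {k c : ℕ} (h : run (start k) w = done) (hc : c ≤ 1) : c ∈ w := by
  induction k generalizing w with
  | zero =>
    obtain ⟨w', rfl, -, h0⟩ := run_last_iff.1 h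
    interval_cases c <;> simp [h0]
  | succ k ih =>
    obtain ⟨j, w', rfl, -, hw'⟩ := exists_eq_of_run_block h
    simp only [List.mem_append, List.mem_cons, ih hw', or_true]

theorem count_of_run_start {k l : ℕ} (h : run (start k) w = done) (hl : 2 ≤ l) :
    w.count l = if 3 ≤ l ∧ l ≤ k + 2 then 1 else 0 := by
  induction k generalizing w with
  | zero =>
    obtain ⟨w', rfl, hw', -⟩ := run_last_iff.1 h
    rw [if_neg (by omega), List.count_eq_zero, List.mem_cons]
    rintro (rfl | hmem)
    · omega
    · have := hw' l hmem; omega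
  | succ k ih =>
    obtain ⟨j, w', rfl, -, hw'⟩ := exists_eq_of_run_block h
    have hck : blockLetter k ≠ l := by have := blockLetter_le_one k; omega
    simp only [List.count_append, List.count_replicate, List.count_cons, beq_iff_eq, hck, if_false,
      ih hw']
    split_ifs <;> omega

end Accepted

end State

open State

/-- The words read by the automaton that contain `b` twice, as lists of letters; for `n ≥ 1` they
form the `β`-class of `v_n`. -/
def vLanguage (n : ℕ) : Set (List ℕ) := {w | run (start n) w = done ∧ 2 ≤ w.count 1}

theorem commonPrefix_append_mem_vLanguage (n : ℕ) :
    commonPrefix n ++ [1, 1, 0, 0] ∈ vLanguage n :=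
  ⟨by rw [run_append, run_commonPrefix]; rfl, by simp [List.count_append]⟩

theorem le_one_of_mem_vLanguage {n l : ℕ} {w : List ℕ} (hw : w ∈ vLanguage n)
    (hl : 2 ≤ w.count l) : l ≤ 1 := by
  by_contra! h
  have := count_of_run_start hw.1 h
  split_ifs at this <;> omega

theorem count_three_of_mem_vLanguage {n : ℕ} (hn : 1 ≤ n) {w : List ℕ} (hw : w ∈ vLanguage n) :
    w.count 3 = 1 := by
  rw [count_of_run_start hw.1 (by decide), if_pos (by omega)]

theorem absorb_mem_vLanguage_iff {n : ℕ} {A D C B : List ℕ} (hC : C ⊆ D)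
    (hD : ∀ d ∈ D, 2 ≤ (A ++ D ++ B).count d) :
    A ++ D ++ C ++ B ∈ vLanguage n ↔ A ++ D ++ B ∈ vLanguage n := by
  have count_le : ∀ l, (A ++ D ++ B).count l ≤ (A ++ D ++ C ++ B).count l := fun l => by
    simp only [List.count_append]; omega
  have run_eq (hle : ∀ d ∈ D, d ≤ 1) :
      run (start n) (A ++ D ++ C ++ B) = run (start n) (A ++ D ++ B) := by
    rw [List.append_assoc A, run_append, run_append, run_append_of_subset _ hle hC, ← run_append,
      ← run_append, List.append_assoc]
  have two_le_iff : 2 ≤ (A ++ D ++ C ++ B).count 1 ↔ 2 ≤ (A ++ D ++ B).count 1 := by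
    by_cases h1 : 1 ∈ C
    · have := hD 1 (hC h1)
      exact iff_of_true (this.trans (count_le 1)) this
    · simp only [List.count_append, List.count_eq_zero_of_not_mem h1, add_zero]
  constructor <;> intro h
  · have hle : ∀ d ∈ D, d ≤ 1 := fun d hd =>
      le_one_of_mem_vLanguage h ((hD d hd).trans (count_le d))
    exact ⟨run_eq hle ▸ h.1, two_le_iff.1 h.2⟩
  · have hle : ∀ d ∈ D, d ≤ 1 := fun d hd => le_one_of_mem_vLanguage h (hD d hd)
    exact ⟨(run_eq hle).symm ▸ h.1, two_le_iff.2 h.2⟩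

/-! ### The class of `v_n` -/

/-- The syntactic congruence of a language, as a congruence on the free monoid. The quotient by it
separates the words of the language from all others. -/
def syntacticCon (L : Set (List ℕ)) : Con Word where
  r v w := ∀ P S : List ℕ, P ++ v.toList ++ S ∈ L ↔ P ++ w.toList ++ S ∈ L
  iseqv :=
    { refl := fun _ _ _ => Iff.rfl
      symm := fun h P S => (h P S).symm
      trans := fun h h' P S => (h P S).trans (h' P S) }
  mul' {v v' w w'} h h' P S := by
    have hv := h P (w.toList ++ S)
    have hw := h' (P ++ v'.toList) S
    simp only [FreeMonoid.toList_mul, List.append_assoc] at hv hw ⊢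
    exact hv.trans hw

theorem isE1_syntacticCon_quotient {L : Set (List ℕ)}
    (hL : ∀ {A D C B : List ℕ}, C ⊆ D → (∀ d ∈ D, 2 ≤ (A ++ D ++ B).count d) →
      (A ++ D ++ C ++ B ∈ L ↔ A ++ D ++ B ∈ L)) :
    IsE1 (syntacticCon L).Quotient := by
  have surj := (syntacticCon L).mk'_surjective
  have one_le {w : List ℕ} {d : ℕ} (hd : d ∈ w) : 1 ≤ w.count d := List.count_pos_iff.2 hd
  have mul_mul_self_iff (x s P S : List ℕ) :
      P ++ (x ++ s ++ x) ++ S ∈ L ↔ P ++ (x ++ s ++ (x ++ x)) ++ S ∈ L := by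
    simpa only [List.append_assoc] using (hL (A := P ++ x ++ s) (B := S) (List.Subset.refl x)
      fun d hd => by have := one_le hd; simp only [List.count_append]; omega).symm
  have sq_mul_mul_iff (x s P S : List ℕ) :
      P ++ (x ++ s ++ x) ++ S ∈ L ↔ P ++ (x ++ x ++ s ++ x) ++ S ∈ L := by
    simpa only [List.append_assoc] using (hL (A := P) (B := s ++ x ++ S) (List.Subset.refl x)
      fun d hd => by have := one_le hd; simp only [List.count_append]; omega).symm
  have sandwich_iff (x y P S : List ℕ) :
      P ++ (x ++ (y ++ y) ++ x) ++ S ∈ L ↔ P ++ (x ++ x ++ (y ++ y)) ++ S ∈ L := by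
    have left := hL (A := P) (B := y ++ y ++ x ++ S) (List.Subset.refl x)
      fun d hd => by have := one_le hd; simp only [List.count_append]; omega
    have right := hL (A := P) (D := x ++ x ++ y ++ y) (C := x) (B := S)
      (fun d hd => by simp only [List.mem_append, hd, true_or])
      fun d hd => by
        simp only [List.mem_append, or_self, or_assoc] at hd
        obtain hd | hd := hd <;> have := one_le hd <;> simp only [List.count_append] <;> omega
    simp only [List.append_assoc] at left right ⊢
    exact left.symm.trans right
  constructor <;> refine surj.forall₂.2 fun x y => ?_ <;> simp only [pow_two] <;>
    refine (Con.eq _).2 fun P S => ?_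
  · exact mul_mul_self_iff x.toList y.toList P S
  · exact (mul_mul_self_iff x.toList y.toList P S).symm.trans (sq_mul_mul_iff x.toList y.toList P S)
  · exact sandwich_iff x.toList y.toList P S

theorem MonoidVariety.Models.mem_iff_of_mem_syntacticCon {V : MonoidVariety.{0}} {L : Set (List ℕ)}
    (hV : V.Mem (syntacticCon L).Quotient) {p q : Word} (h : V.Models p q) :
    p.toList ∈ L ↔ q.toList ∈ L := by
  have lift_eq (w : Word) :
      FreeMonoid.lift (fun x => (syntacticCon L).mk' (FreeMonoid.of x)) w
        = (syntacticCon L).mk' w :=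
    DFunLike.congr_fun (FreeMonoid.hom_eq fun x => FreeMonoid.lift_eval_of _ x) w
  have := h _ hV fun x => (syntacticCon L).mk' (FreeMonoid.of x)
  rw [lift_eq, lift_eq] at this
  simpa only [List.nil_append, List.append_nil] using (Con.eq _).1 this [] []

section Eval

variable {N : Type*} [Monoid N] (hN : IsE1 N) (g : ℕ → N) {A w : List ℕ}
include hN

theorem IsE1.eval_append_of_run_last (h : run last w = done) (h0 : 0 ∈ A)
    (h1 : 2 ≤ (A ++ w).count 1) : eval g (A ++ w) = eval g (A ++ [1, 1, 0, 0]) := by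
  obtain ⟨w', rfl, hw', hmem⟩ := run_last_iff.1 h
  obtain ⟨X, Y, rfl, hX⟩ := List.eq_append_cons_of_mem hmem
  have hXY : ∀ l ∈ X ++ 0 :: Y, l = 0 ∨ l = 1 := fun l hl => by have := hw' l hl; omega
  have hX1 : X ⊆ [1, 1] := fun l hl => by
    obtain rfl | rfl := hXY l (List.mem_append_left _ hl)
    · exact absurd hl hX
    · exact List.mem_cons_self
  have hY : Y ⊆ [1, 1, 0] := fun l hl => by
    obtain rfl | rfl := hXY l (List.mem_append_right _ (List.mem_cons_of_mem _ hl)) <;> simp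
  have h0' : 1 ≤ A.count 0 := List.count_pos_iff.2 h0
  have h2 : ∀ d ∈ [1, 1, 0], 2 ≤ (A ++ [1, 1, 0] ++ []).count d := by
    grind
  calc eval g (A ++ 1 :: (X ++ 0 :: Y))
      = eval g (A ++ 1 :: 1 :: (X ++ 0 :: Y)) := (hN.eval_duplicate g h1).symm
    _ = eval g (A ++ [1, 1] ++ X ++ 0 :: Y) := by simp only [List.append_assoc]; rfl
    _ = eval g (A ++ [1, 1] ++ 0 :: Y) := hN.eval_absorb g hX1 (by
      grind)
    _ = eval g (A ++ [1, 1, 0] ++ Y ++ []) := by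
      simp only [List.append_nil, List.append_assoc]; rfl
    _ = eval g (A ++ [1, 1, 0] ++ []) := hN.eval_absorb g hY h2
    _ = eval g (A ++ [1, 1, 0] ++ [0] ++ []) := (hN.eval_absorb g (by simp) h2).symm
    _ = eval g (A ++ [1, 1, 0, 0]) := by simp only [List.append_nil, List.append_assoc]; rfl

theorem IsE1.eval_append_of_run_start {k : ℕ} (h : run (start k) w = done)
    (hA : k = 0 → 0 ∈ A) (h1 : 2 ≤ (A ++ w).count 1) :
    eval g (A ++ w) = eval g (A ++ (commonPrefix k ++ [1, 1, 0, 0])) := by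
  induction k generalizing A w with
  | zero => exact hN.eval_append_of_run_last g h (hA rfl) h1
  | succ k ih =>
    obtain ⟨j, w', rfl, hj, hw'⟩ := exists_eq_of_run_block h
    have hk : 1 ≤ w'.count (blockLetter k) :=
      List.count_pos_iff.2 (mem_of_run_start hw' (blockLetter_le_one k))
    obtain ⟨i, rfl⟩ := Nat.exists_eq_succ_of_ne_zero (hj rfl)
    have habs := hN.eval_absorb g (A := A) (D := [blockLetter k])
      (C := List.replicate i (blockLetter k)) (B := (k + 3) :: w')
      (List.replicate_subset_singleton i _)
      (by grind)
    have hind := ih (A := A ++ [blockLetter k, k + 3]) hw' (by rintro rfl; simp) (by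
      by_cases hk1 : blockLetter k = 1
      · rw [hk1] at hk
        grind
      · simpa [List.count_append, List.count_replicate, hk1] using h1)
    simp only [List.append_assoc, List.cons_append, List.nil_append] at habs hind
    rw [Nat.succ_eq_add_one, List.replicate_succ, List.cons_append, habs, hind]
    rfl

end Eval

theorem mem_betaClass_vWord_iff {n : ℕ} (hn : 1 ≤ n) (w : Word) :
    w ∈ betaClass (vWord n) ↔ w.toList ∈ vLanguage n := by
  constructor
  · intro h
    have hE1 := mem_E1_iff.2 (isE1_syntacticCon_quotient (absorb_mem_vLanguage_iff (n := n)))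
    refine (MonoidVariety.Models.mem_iff_of_mem_syntacticCon hE1 h).1 ?_
    rw [toList_vWord]
    exact commonPrefix_append_mem_vLanguage n
  · intro h N _ hN g
    rw [lift_eq_eval, lift_eq_eval, toList_vWord]
    exact ((mem_E1_iff.1 hN).eval_append_of_run_start g (A := []) h.1 (by omega) h.2).symm

theorem ofList_preimage_betaClass_vWord {n : ℕ} (hn : 1 ≤ n) :
    ofList ⁻¹' betaClass (vWord n) = vLanguage n :=
  Set.ext fun w => mem_betaClass_vWord_iff hn (ofList w)

theorem mem_betaClass_of_beta {v x y : Word} (h : beta x y) (hx : x ∈ betaClass v) :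
    y ∈ betaClass v := beta.trans hx h

theorem betaClass_eq_of_mem {v w : Word} (h : w ∈ betaClass v) : betaClass w = betaClass v :=
  Set.ext fun _ => ⟨beta.trans h, beta.trans (beta.symm h)⟩

/-! ### `M_β([v_n])` belongs to `𝔼¹{σ_{n+1}}` -/

namespace State

theorem level_step_le (q : State) (l : ℕ) : level (step q l) ≤ level q := by
  cases q with
  | dead => exact le_rfl
  | block k seen =>
    rw [step]
    split_ifs
    · exact le_rfl
    · rw [level_start]; exact Nat.le_succ k
    · exact Nat.zero_le _
  | last => rw [step]; split_ifs <;> exact le_rfl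
  | lastB => rw [step]; split_ifs <;> exact le_rfl
  | done => rw [step]; split_ifs <;> exact le_rfl

theorem level_run_le (q : State) (w : List ℕ) : level (run q w) ≤ level q := by
  induction w generalizing q with
  | nil => exact le_rfl
  | cons l w ih => exact (ih _).trans (level_step_le q l)

theorem eq_block_of_level_eq_succ {q : State} {k : ℕ} (h : level q = k + 1) :
    ∃ seen, q = block k seen := by
  cases q with
  | block j seen => exact ⟨seen, by rw [Nat.succ.inj h]⟩
  | _ => cases h

theorem level_and_eq_blockLetter_of_level_run {q : State} {w : List ℕ} {k : ℕ}
    (hw : ∀ l ∈ w, l ≤ 1) (h : level (run q w) = k + 1) :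
    level q = k + 1 ∧ ∀ l ∈ w, l = blockLetter k := by
  induction w generalizing q with
  | nil => exact ⟨h, fun _ hl => absurd hl List.not_mem_nil⟩
  | cons l w ih =>
    rw [List.forall_mem_cons] at hw
    obtain ⟨hstep, hrest⟩ := ih hw.2 h
    obtain ⟨j, hj⟩ : ∃ j, level q = j + 1 :=
      Nat.exists_eq_succ_of_ne_zero (by have := level_step_le q l; omega)
    obtain ⟨seen, rfl⟩ := eq_block_of_level_eq_succ hj
    by_cases hl : l = blockLetter j
    · rw [hl, step_block_blockLetter] at hstep
      obtain rfl : j = k := Nat.succ.inj hstep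
      exact ⟨rfl, List.forall_mem_cons.2 ⟨hl, hrest⟩⟩
    · rw [step, if_neg hl, if_neg (by omega)] at hstep
      cases hstep

theorem le_one_of_level_eq_zero {q : State} {w : List ℕ} (hq : level q = 0)
    (h : run q w = done) : ∀ l ∈ w, l ≤ 1 := by
  cases q with
  | dead => rw [run_dead] at h; cases h
  | block k seen => cases hq
  | last =>
    obtain ⟨w', rfl, hw', -⟩ := run_last_iff.1 h
    exact List.forall_mem_cons.2 ⟨le_rfl, hw'⟩
  | lastB => exact (run_lastB_iff.1 h).1
  | done => exact run_done_iff.1 h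

/-- If `t_1` is sent to a word with a letter `t_j`, then each of the letters `t_{m+1}, …, t_1` of
the common prefix is read at a smaller level than the previous one, since the images of `a` and `b`
are read in blocks with different letters. -/
theorem exists_level_eq_of_run_flatMap_commonPrefix {φ : ℕ → List ℕ}
    (hab : ∀ l ∈ φ 0 ++ φ 1, l ≤ 1) (hne : ¬ ∃ c, ∀ l ∈ φ 0 ++ φ 1, l = c)
    (ht : ∃ l ∈ φ 3, 2 ≤ l) (m : ℕ) {q : State} {S : List ℕ}
    (h : run q ((commonPrefix (m + 1)).flatMap φ ++ S) = done) :
    ∃ k, m ≤ k ∧ level q = k + 1 ∧ ∀ l ∈ φ (blockLetter m), l = blockLetter k := by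
  have le_one (m : ℕ) : ∀ l ∈ φ (blockLetter m), l ≤ 1 := fun l hl => hab l <| by
    obtain ⟨hm, -⟩ | ⟨hm, -⟩ := blockLetter_eq_and_succ_eq m <;> rw [hm] at hl <;>
      simp only [List.mem_append, hl, true_or, or_true]
  induction m generalizing q with
  | zero =>
    rw [commonPrefix, List.flatMap_cons, List.flatMap_cons, List.append_assoc, run_append] at h
    obtain ⟨l, hl, hl2⟩ := ht
    obtain ⟨k, hk⟩ : ∃ k, level (run q (φ (blockLetter 0))) = k + 1 :=
      Nat.exists_eq_succ_of_ne_zero fun h0 => by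
        have := le_one_of_level_eq_zero h0 h l
          (List.mem_append_left _ (List.mem_append_left _ hl))
        omega
    obtain ⟨hq, hφ⟩ := level_and_eq_blockLetter_of_level_run (le_one 0) hk
    exact ⟨k, k.zero_le, hq, hφ⟩
  | succ m ih =>
    rw [commonPrefix, List.flatMap_cons, List.flatMap_cons, List.append_assoc, List.append_assoc,
      run_append, run_append] at h
    obtain ⟨j, hmj, hj, hφj⟩ := ih h
    have hle := level_run_le (run q (φ (blockLetter (m + 1)))) (φ (m + 1 + 3))
    obtain ⟨k, hk⟩ : ∃ k, level (run q (φ (blockLetter (m + 1)))) = k + 1 :=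
      Nat.exists_eq_succ_of_ne_zero (by omega)
    obtain ⟨hq, hφk⟩ := level_and_eq_blockLetter_of_level_run (le_one (m + 1)) hk
    have hjk : j ≠ k := by
      rintro rfl
      refine hne ⟨blockLetter j, fun l hl => ?_⟩
      obtain ⟨hj0, hk1⟩ | ⟨hj1, hk0⟩ := blockLetter_eq_and_succ_eq m
      · rw [hj0] at hφj; rw [hk1] at hφk
        exact (List.mem_append.1 hl).elim (hφj l) (hφk l)
      · rw [hj1] at hφj; rw [hk0] at hφk
        exact (List.mem_append.1 hl).elim (hφk l) (hφj l)
    exact ⟨k, by omega, hq, hφk⟩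

end State

theorem IsE1.eval_sq_mul_sq_comm_of_subset {N : Type*} [Monoid N] (hN : IsE1 N) {α : Type*}
    (g : α → N) (A : List α) {X Y T : List α} (hT : T ⊆ X ++ Y) :
    eval g (A ++ X ++ T ++ (X ++ X ++ Y ++ Y)) = eval g (A ++ X ++ T ++ (Y ++ Y ++ X ++ X)) := by
  classical
  have one_le {w : List α} {d : α} (hd : d ∈ w) : 1 ≤ w.count d := List.count_pos_iff.2 hd
  have long := hN.eval_absorb g (A := A) (D := X ++ T ++ X ++ X ++ Y ++ Y) (C := X ++ X) (B := [])
    (by grind) fun d hd => by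
      obtain hd | hd : d ∈ X ∨ d ∈ Y := by grind
      all_goals have := one_le hd; simp only [List.count_append]; omega
  have short := hN.eval_absorb g (A := A) (D := X ++ T) (C := X ++ X) (B := Y ++ Y ++ X ++ X)
    (by grind) fun d hd => by
      obtain hd | hd : d ∈ X ∨ d ∈ Y := by grind
      all_goals have := one_le hd; simp only [List.count_append]; omega
  simp only [List.append_assoc, List.append_nil] at long short ⊢
  rw [← long, short]

theorem IsE1.eval_flatMap_sigma {N : Type*} [Monoid N] (hN : IsE1 N) (g : ℕ → N) {n : ℕ}
    {φ : ℕ → List ℕ} {P R S : List ℕ} (hR : R = [0, 0, 1, 1] ∨ R = [1, 1, 0, 0])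
    (h : P ++ (commonPrefix (n + 1) ++ R).flatMap φ ++ S ∈ vLanguage n) :
    eval g ((commonPrefix (n + 1) ++ [0, 0, 1, 1]).flatMap φ)
      = eval g ((commonPrefix (n + 1) ++ [1, 1, 0, 0]).flatMap φ) := by
  have hab : ∀ l ∈ φ 0 ++ φ 1, l ≤ 1 := fun l hl => le_one_of_mem_vLanguage h <| by
    have : 1 ≤ (φ 0 ++ φ 1).count l := List.count_pos_iff.2 hl
    obtain rfl | rfl := hR <;>
      simp only [List.flatMap_append, List.flatMap_cons, List.count_append] at this ⊢ <;> omega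
  by_cases hc : ∃ c, ∀ l ∈ φ 0 ++ φ 1, l = c
  · obtain ⟨c, hc⟩ := hc
    obtain ⟨h0, h1⟩ := List.forall_mem_append.1 hc
    obtain ⟨i, hi⟩ : ∃ i, φ 0 = List.replicate i c := ⟨_, List.eq_replicate_of_mem h0⟩
    obtain ⟨j, hj⟩ : ∃ j, φ 1 = List.replicate j c := ⟨_, List.eq_replicate_of_mem h1⟩
    simp only [List.flatMap_append, List.flatMap_cons, List.flatMap_nil, List.append_nil, hi, hj,
      List.replicate_append_replicate]
    congr 3
    omega
  have ht : ∀ l ∈ φ 3, l ≤ 1 := by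
    by_contra! ht
    rw [List.flatMap_append] at h
    have hrun : run (run (start n) P) ((commonPrefix (n + 1)).flatMap φ ++ (R.flatMap φ ++ S))
        = done := by
      rw [← run_append]; simpa only [List.append_assoc] using h.1
    obtain ⟨k, hk, hlevel, -⟩ := exists_level_eq_of_run_flatMap_commonPrefix hab hc ht n hrun
    have := level_run_le (start n) P
    rw [level_start] at this
    omega
  have hsub : φ 3 ⊆ φ 0 ++ φ 1 := fun l hl => by
    by_contra hlab
    refine hc ⟨1 - l, fun x hx => ?_⟩
    have hxl : x ≠ l := fun e => hlab (e ▸ hx)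
    have := hab x hx
    have := ht l hl
    omega
  obtain ⟨H, hH⟩ := commonPrefix_succ_eq_append n
  simpa only [hH, List.flatMap_append, List.flatMap_cons, List.flatMap_nil, List.append_nil,
    List.append_assoc] using hN.eval_sq_mul_sq_comm_of_subset g (H.flatMap φ) hsub

theorem mem_E1sigma_MW {n : ℕ} (hn : 1 ≤ n) :
    (E1sigma.{0} (n + 1)).Mem (MW beta (betaClass (vWord n))) := by
  refine mem_E1sigma_iff.2 ⟨mem_E1_iff.1 fun p hp => ?_, satisfies_MW_iff.2 fun φ => ?_⟩
  · have hmodels : E1.{0}.Models p.1 p.2 := fun N _ hN => hN p hp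
    exact satisfies_MW_iff.2 fun φ => Or.inl (hmodels.subst φ)
  have hlift (w : Word) : FreeMonoid.lift φ w = ofList (w.toList.flatMap fun x => (φ x).toList) :=
    lift_ofList_flatMap (fun x => (φ x).toList) w
  have hbeta {R : List ℕ} (hR : R = [0, 0, 1, 1] ∨ R = [1, 1, 0, 0])
      (hout : (ofList ((commonPrefix (n + 1) ++ R).flatMap fun x => (φ x).toList) : beta.Quotient)
        ∉ outside beta (betaClass (vWord n))) :
      beta (FreeMonoid.lift φ (uWord (n + 1))) (FreeMonoid.lift φ (vWord (n + 1))) := by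
    obtain ⟨P, S, hPS⟩ := (notMem_outside_iff fun _ _ => mem_betaClass_of_beta).1 hout
    intro N _ hN g
    rw [hlift, hlift, lift_eq_eval, lift_eq_eval, toList_uWord, toList_vWord]
    exact (mem_E1_iff.1 hN).eval_flatMap_sigma g hR ((mem_betaClass_vWord_iff hn _).1 hPS)
  refine or_iff_not_imp_left.2 fun hne => ?_
  rw [hlift (uWord (n + 1)), hlift (vWord (n + 1)), toList_uWord, toList_vWord]
  exact ⟨by_contra fun hout => hne (hbeta (Or.inl rfl) hout),
    by_contra fun hout => hne (hbeta (Or.inr rfl) hout)⟩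

/-! ### Invariants of substitution equivalence -/

theorem flatMap_eq_replicate {α β : Type*} [DecidableEq α] {φ : α → List β} {x : α} {c : β}
    {w : List α} (hx : φ x = [c]) (h : ∀ l ∈ w, l ≠ x → φ l = []) :
    w.flatMap φ = List.replicate (w.count x) c := by
  induction w with
  | nil => rfl
  | cons l w ih =>
    obtain ⟨hl, hw⟩ := List.forall_mem_cons.1 h
    rw [List.flatMap_cons, ih hw]
    obtain rfl | hlx := eq_or_ne l x
    · rw [hx, List.count_cons_self]; rfl
    · rw [hl hlx, List.count_cons_of_ne hlx]; rfl

theorem append_mem_vLanguage {n i : ℕ} {L W : List ℕ} (hL : run (start n) L = start 1)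
    (hi : i ≠ 0) (hW : run last W = done) (hW1 : 2 ≤ W.count 1) :
    L ++ (List.replicate i 0 ++ 3 :: W) ∈ vLanguage n := by
  refine ⟨?_, by simp only [List.count_append, List.count_cons]; omega⟩
  have hread : run (start 1) (List.replicate i 0) = block 0 true := run_block_replicate 0 false hi
  rw [run_append, hL, run_append, hread, run_cons, step_block_true]
  exact hW

theorem append_notMem_vLanguage {n i : ℕ} {L W : List ℕ} (hL : run (start n) L = start 1)
    (hi : i ≠ 0) : L ++ (List.replicate i 0 ++ 3 :: 0 :: W) ∉ vLanguage n := by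
  intro hmem
  have hread : run (start 1) (List.replicate i 0) = block 0 true := run_block_replicate 0 false hi
  have hdead : run (start n) (L ++ (List.replicate i 0 ++ 3 :: 0 :: W)) = dead := by
    rw [run_append, hL, run_append, hread, run_cons, step_block_true]
    exact run_dead W
  exact absurd (hdead.symm.trans hmem.1) nofun

namespace SubstEquiv

variable {n : ℕ} (hn : 1 ≤ n) {U V : List ℕ} (h : SubstEquiv (vLanguage n) U V)
include hn h

theorem count_eq {x : ℕ} (hx : U.count x ≤ 1) : V.count x = U.count x := by
  obtain ⟨L, hL⟩ := exists_run_start_eq hn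
  have hφ (w : List ℕ) : w.flatMap (fun l => if l = x then [3] else [])
      = List.replicate (w.count x) 3 :=
    flatMap_eq_replicate (if_pos rfl) fun _ _ hl => if_neg hl
  have hU : L ++ [0] ++ List.replicate (U.count x) 3
      ++ (List.replicate (1 - U.count x) 3 ++ [1, 1, 0]) ∈ vLanguage n := by
    have := append_mem_vLanguage hL one_ne_zero (W := [1, 1, 0]) rfl le_rfl
    interval_cases U.count x <;> simpa using this
  have hV := (h (fun l => if l = x then [3] else []) _ _).1 ((hφ U).symm ▸ hU)
  have hU3 := count_three_of_mem_vLanguage hn hU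
  have hV3 := count_three_of_mem_vLanguage hn hV
  simp only [hφ, List.count_append, List.count_replicate_self] at hU3 hV3
  omega

theorem two_le_count_iff {x : ℕ} : 2 ≤ U.count x ↔ 2 ≤ V.count x := by
  have := h.count_eq hn (x := x)
  have := h.symm.count_eq hn (x := x)
  omega

theorem mem_between {s r x : ℕ} {U₁ U₂ U₃ V₁ V₂ V₃ : List ℕ} (hU : U = U₁ ++ s :: U₂ ++ r :: U₃)
    (hV : V = V₁ ++ s :: V₂ ++ r :: V₃) (hs : U.count s = 1) (hr : U.count r = 1)
    (hxs : x ≠ s) (hxr : x ≠ r) (hx : x ∈ V₂) : x ∈ U₂ := by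
  by_contra hxU
  obtain ⟨L, hL⟩ := exists_run_start_eq hn
  have hsV := (h.count_eq hn hs.le).trans hs
  have hrV := (h.count_eq hn hr.le).trans hr
  subst hU hV
  simp only [List.count_append, List.count_cons_self] at hs hr hsV hrV
  have hsr : r ≠ s := by rintro rfl; simp only [List.count_cons_self] at hs; omega
  let φ : ℕ → List ℕ := fun l =>
    if l = s then [3] else if l = r then [1, 1] else if l = x then [0] else []
  have hφs : φ s = [3] := if_pos rfl
  have hφr : φ r = [1, 1] := by simp only [φ, hsr, if_true, if_false]
  have hφ {w : List ℕ} (hws : w.count s = 0) (hwr : w.count r = 0) :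
      w.flatMap φ = List.replicate (w.count x) 0 :=
    flatMap_eq_replicate (by simp only [φ, hxs, hxr, if_true, if_false]) fun l hl hlx => by
      have hls : l ≠ s := by rintro rfl; exact List.count_eq_zero.1 hws hl
      have hlr : l ≠ r := by rintro rfl; exact List.count_eq_zero.1 hwr hl
      simp only [φ, hls, hlr, hlx, if_false]
  have hUmem := append_mem_vLanguage hL (U₁.count x).succ_ne_zero
    (W := [1, 1] ++ List.replicate (U₃.count x) 0 ++ [0])
    (run_last_iff.2 ⟨_, rfl, by simp +contextual [or_imp, List.mem_replicate], by simp⟩) (by simp)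
  have hVmem := (h φ (L ++ [0]) [0]).1 <| by
    simp only [List.flatMap_append, List.flatMap_cons, hφs, hφr]
    rw [hφ (w := U₁), hφ (w := U₂), hφ (w := U₃), List.count_eq_zero_of_not_mem hxU]
    · simpa [List.replicate_succ] using hUmem
    all_goals simp only [List.count_cons_of_ne hsr, List.count_cons_of_ne hsr.symm] at hs hr ⊢
    all_goals omega
  obtain ⟨j, hj⟩ : ∃ j, V₂.count x = j + 1 :=
    Nat.exists_eq_succ_of_ne_zero (List.count_pos_iff.2 hx).ne'
  simp only [List.flatMap_append, List.flatMap_cons, hφs, hφr] at hVmem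
  rw [hφ (w := V₁), hφ (w := V₂), hj] at hVmem
  · refine append_notMem_vLanguage hL (V₁.count x).succ_ne_zero
      (W := List.replicate j 0 ++ ([1, 1] ++ V₃.flatMap φ) ++ [0]) ?_
    simpa [List.replicate_succ] using hVmem
  all_goals simp only [List.count_cons_of_ne hsr, List.count_cons_of_ne hsr.symm] at hsV hrV ⊢
  all_goals omega

end SubstEquiv

/-! ### Alternations -/

section Alternation

variable {α : Type*} {K : α → Prop} {x y z z' s : α} {P T : List α} {d : ℕ}

/-- The letters `x` and `y` both occur in a factor of `P` consisting of letters from `K`. -/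
def ShareBlock (K : α → Prop) (x y : α) (P : List α) : Prop :=
  ∃ A D B, P = A ++ D ++ B ∧ x ∈ D ∧ y ∈ D ∧ ∀ l ∈ D, K l

theorem ShareBlock.append (h : ShareBlock K x y P) (R : List α) : ShareBlock K x y (P ++ R) := by
  obtain ⟨A, D, B, rfl, hD⟩ := h
  exact ⟨A, D, B ++ R, by simp only [List.append_assoc], hD⟩

/-- The list `P` splits into an initial part without `z` and `z'` and `d` further parts that contain
alternately only one of them, the last one containing `z`; each of these parts ends with a letter
outside `K`. -/
inductive Alternates (K : α → Prop) : ℕ → α → α → List α → Prop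
  | nil {z z' : α} {P : List α} (hz : z ∉ P) (hz' : z' ∉ P) : Alternates K 0 z z' P
  | step {d : ℕ} {z z' s : α} {P Q : List α} (h : Alternates K d z z' P) (hz : z ∉ Q)
      (hz' : z' ∈ Q) (hs : ¬ K s) : Alternates K (d + 1) z' z (P ++ Q ++ [s])

theorem Alternates.append_append_singleton (h : Alternates K d z z' P) (hz : K z) (hz' : K z')
    (hs : ¬ K s) (hT : z ∉ T ∨ z' ∉ T) :
    ∃ e w w', s(w, w') = s(z, z') ∧ Alternates K e w w' (P ++ T ++ [s]) := by
  have hsz : z ≠ s := by rintro rfl; exact hs hz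
  have hsz' : z' ≠ s := by rintro rfl; exact hs hz'
  by_cases hzT' : z' ∈ T
  · exact ⟨d + 1, z', z, Sym2.eq_swap, h.step (hT.resolve_right (not_not.2 hzT')) hzT' hs⟩
  cases h with
  | nil h₁ h₂ =>
    by_cases hzT : z ∈ T
    · exact ⟨1, z, z', rfl, (Alternates.nil h₂ h₁).step hzT' hzT hs⟩
    · exact ⟨0, z, z', rfl, .nil (by simp [h₁, hzT, hsz]) (by simp [h₂, hzT', hsz'])⟩
  | @step d _ _ r P Q h hQ hzQ hr =>
    refine ⟨d + 1, z, z', rfl, ?_⟩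
    have hQ' : z' ∉ Q ++ [r] ++ T := by
      simp only [List.mem_append, List.mem_singleton, hQ, hzT', or_false, false_or]
      rintro rfl
      exact hr hz'
    simpa only [List.append_assoc] using
      h.step (Q := Q ++ [r] ++ T) hQ' (by simp only [List.mem_append, hzQ, true_or]) hs

theorem shareBlock_or_alternates (hx : K x) (hy : K y) (P : List α) (hT : ∀ l ∈ T, K l)
    (hs : ¬ K s) : ShareBlock K x y (P ++ T) ∨
      ∃ d z z', s(z, z') = s(x, y) ∧ Alternates K d z z' (P ++ T ++ [s]) := by
  have close {A T : List α} {d : ℕ} {z z' s : α} (hT : ∀ l ∈ T, K l) (hs : ¬ K s)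
      (hzz' : s(z, z') = s(x, y)) (h : Alternates K d z z' A) : ShareBlock K x y (A ++ T) ∨
        ∃ d z z', s(z, z') = s(x, y) ∧ Alternates K d z z' (A ++ T ++ [s]) := by
    by_cases hboth : x ∈ T ∧ y ∈ T
    · exact Or.inl ⟨A, T, [], by rw [List.append_nil], hboth.1, hboth.2, hT⟩
    have hKz : K z ∧ K z' ∧ (z ∉ T ∨ z' ∉ T) := by
      obtain ⟨rfl, rfl⟩ | ⟨rfl, rfl⟩ := Sym2.eq_iff.1 hzz'
      · exact ⟨hx, hy, not_and_or.1 hboth⟩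
      · exact ⟨hy, hx, (not_and_or.1 hboth).symm⟩
    obtain ⟨e, w, w', hw, hP⟩ := h.append_append_singleton hKz.1 hKz.2.1 hs hKz.2.2
    exact Or.inr ⟨e, w, w', hw.trans hzz', hP⟩
  induction P using List.reverseRecOn generalizing T s with
  | nil => exact close hT hs rfl (.nil List.not_mem_nil List.not_mem_nil)
  | append_singleton P l ih =>
    by_cases hl : K l
    · simpa only [List.append_assoc] using ih (T := [l] ++ T) (List.forall_mem_cons.2 ⟨hl, hT⟩) hs
    · obtain h | ⟨d, z, z', hzz', h⟩ := ih (T := []) (by simp) hl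
      · rw [List.append_nil] at h
        exact Or.inl ((h.append [l]).append T)
      · rw [List.append_nil] at h
        exact close hT hs hzz' h

/-- The alternating list of length `k` in `z` and `z'` with last entry `z`, which is the pattern of
the letters `a` and `b` in `commonPrefix k`. -/
def alternating : ℕ → α → α → List α
  | 0, _, _ => []
  | k + 1, z, z' => alternating k z' z ++ [z]

theorem Alternates.alternating_sublist (h : Alternates K d z z' P) :
    (alternating d z z').Sublist P := by
  induction h with
  | nil => exact List.nil_sublist _
  | step _ _ hz' _ ih =>
    exact (ih.append (List.singleton_sublist.2 hz')).trans (List.sublist_append_left _ _)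

theorem alternating_succ_eq_cons (k : ℕ) (z z' : α) :
    alternating (k + 1) z z' = (if Even k then z else z') :: alternating k z z' := by
  induction k generalizing z z' with
  | zero => rfl
  | succ k ih =>
    rw [alternating, ih z' z, alternating, List.cons_append]
    by_cases hk : Even k <;> simp [hk, Nat.even_add_one]

theorem alternating_sublist_alternating {j k : ℕ} (hjk : j ≤ k) (z z' : α) :
    (alternating j z z').Sublist (alternating k z z') := by
  induction k, hjk using Nat.le_induction with
  | base => exact List.Sublist.refl _
  | succ k _ ih => rw [alternating_succ_eq_cons]; exact ih.cons _

theorem alternating_subset (k : ℕ) (z z' : α) : alternating k z z' ⊆ [z, z'] := by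
  induction k with
  | zero => exact List.nil_subset _
  | succ k ih =>
    rw [alternating_succ_eq_cons]
    refine List.cons_subset.2 ⟨?_, ih⟩
    split_ifs <;> simp

end Alternation

/-! ### Exchanging adjacent letters -/

section Swap

variable {α N : Type*} [Monoid N] (g : α → N) {m : ℕ} {x y z z' : α} {P S : List α}

theorem exists_eval_eq_mul_eval_commonPrefix (h : (alternating m z z').Sublist P) :
    ∃ (θ : ℕ → N) (c : N), θ 0 = g z ∧ θ 1 = g z' ∧ eval g P = c * eval θ (commonPrefix m) := by
  induction m generalizing P with
  | zero =>
    exact ⟨fun k => if k = 0 then g z else g z', eval g P, rfl, rfl, (mul_one _).symm⟩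
  | succ m ih =>
    rw [alternating_succ_eq_cons, List.cons_sublist_iff] at h
    obtain ⟨P₁, P₂, rfl, hy, hP₂⟩ := h
    obtain ⟨θ, c, h0, h1, hθ⟩ := ih hP₂
    obtain ⟨A, B, rfl⟩ := List.append_of_mem hy
    have hθ' : ∀ l ≠ m + 3, Function.update θ (m + 3) (eval g B * c) l = θ l := fun l hl =>
      Function.update_of_ne hl _ θ
    have hθ_update : eval (Function.update θ (m + 3) (eval g B * c)) (commonPrefix m) =
        eval θ (commonPrefix m) :=
      congr_arg List.prod <| List.map_congr_left fun l hl => hθ' l (lt_of_mem_commonPrefix hl).ne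
    have hletter : g (if Even m then z else z') = θ (blockLetter m) := by
      unfold blockLetter
      split_ifs
      exacts [h0.symm, h1.symm]
    refine ⟨Function.update θ (m + 3) (eval g B * c), eval g A, ?_, ?_, ?_⟩
    · rw [hθ' 0 (by omega), h0]
    · rw [hθ' 1 (by omega), h1]
    · simp only [commonPrefix, eval_append, eval_cons, hθ_update, hθ, hletter,
        hθ' _ (blockLetter_ne m m), Function.update_self, mul_assoc]

variable {g} in
theorem eval_sq_swap_of_alternating (hσ : Satisfies N (uWord m) (vWord m))
    (h : (alternating m z z').Sublist P) (S : List α) :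
    eval g (P ++ z :: z :: z' :: z' :: S) = eval g (P ++ z' :: z' :: z :: z :: S) := by
  obtain ⟨θ, c, h0, h1, hθ⟩ := exists_eval_eq_mul_eval_commonPrefix g h
  have := hσ θ
  simp only [lift_eq_eval, toList_uWord, toList_vWord, eval_append, eval_cons, eval_nil, h0, h1,
    mul_one] at this
  simpa only [eval_append, eval_cons, hθ, mul_assoc] using congr_arg (c * · * eval g S) this

theorem eq_of_forall_swap {β : Type*} (f : List α → β) {w : List α}
    (h : ∀ w₁ y w₂, w = w₁ ++ y :: w₂ →
      f (P ++ w₁ ++ y :: x :: (w₂ ++ S)) = f (P ++ w₁ ++ x :: y :: (w₂ ++ S))) :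
    f (P ++ w ++ x :: S) = f (P ++ x :: w ++ S) := by
  induction w generalizing P with
  | nil => simp only [List.append_nil, List.append_assoc, List.cons_append, List.nil_append]
  | cons y w ih =>
    have hih := ih (P := P ++ [y]) fun w₁ y' w₂ hw => by
      simpa only [List.append_assoc, List.cons_append, List.nil_append] using
        h (y :: w₁) y' w₂ (by rw [hw, List.cons_append])
    have hy := h [] y w rfl
    simp only [List.append_assoc, List.cons_append, List.nil_append] at hih hy ⊢
    exact hih.trans hy

namespace IsE1

variable [DecidableEq α] (hN : IsE1 N) {g}
include hN

theorem eval_swap_of_alternating (hσ : Satisfies N (uWord m) (vWord m))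
    (hz : 2 ≤ (P ++ z :: z' :: S).count z) (hz' : 2 ≤ (P ++ z :: z' :: S).count z')
    (h : (alternating m z z').Sublist P) :
    eval g (P ++ z :: z' :: S) = eval g (P ++ z' :: z :: S) := by
  have square {x y : α} (hx : 2 ≤ (P ++ x :: y :: S).count x)
      (hy : 2 ≤ (P ++ x :: y :: S).count y) :
      eval g (P ++ x :: y :: S) = eval g (P ++ x :: x :: y :: y :: S) := by
    rw [← hN.eval_duplicate g hx]
    have hy' : 2 ≤ ((P ++ [x, x]) ++ y :: S).count y := hy.trans <| by
      simp only [List.count_append, List.count_cons, List.count_nil]; omega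
    simpa only [List.append_assoc, List.cons_append, List.nil_append] using
      (hN.eval_duplicate g hy').symm
  have hperm : (P ++ z :: z' :: S).Perm (P ++ z' :: z :: S) :=
    (List.Perm.swap z' z S).append_left P
  rw [square hz hz', eval_sq_swap_of_alternating hσ h, square (hperm.count_eq z' ▸ hz')
    (hperm.count_eq z ▸ hz)]

theorem eval_swap_of_shareBlock (hσ : Satisfies N (uWord m) (vWord m)) {K : α → Prop}
    (hK : ∀ l, K l → 2 ≤ (P ++ x :: y :: S).count l) (h : ShareBlock K x y P) :
    eval g (P ++ x :: y :: S) = eval g (P ++ y :: x :: S) := by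
  obtain ⟨A, D, B, rfl, hx, hy, hD⟩ := h
  have hC : alternating m x y ⊆ D :=
    List.Subset.trans (alternating_subset m x y)
      (List.cons_subset.2 ⟨hx, List.cons_subset.2 ⟨hy, List.nil_subset D⟩⟩)
  have insert {v : List α} (hv : v.Perm [x, y]) :
      eval g (A ++ D ++ alternating m x y ++ (B ++ (v ++ S))) =
        eval g (A ++ D ++ (B ++ (v ++ S))) := by
    refine hN.eval_absorb g hC fun d hd => (hK d (hD d hd)).trans_eq ?_
    simp only [List.count_append, hv.count_eq, List.count_cons, List.count_nil]
    omega
  have hcount : ∀ l, K l → 2 ≤ ((A ++ D ++ alternating m x y ++ B) ++ x :: y :: S).count l :=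
    fun l hl => (hK l hl).trans <| by simp only [List.count_append]; omega
  have hswap := hN.eval_swap_of_alternating (g := g) hσ (hcount x (hD x hx)) (hcount y (hD y hy))
    ((List.sublist_append_right (A ++ D) _).trans (List.sublist_append_left _ B))
  have hxy := insert (List.Perm.refl [x, y])
  have hyx := insert (List.Perm.swap x y [])
  simp only [List.append_assoc, List.cons_append, List.nil_append] at hswap hxy hyx ⊢
  rw [← hxy, hswap, hyx]

theorem eval_swap_of_mem {A D : List α} (hy : y ∈ D)
    (hD : ∀ d ∈ D ++ [y, x], 2 ≤ (A ++ D ++ y :: x :: S).count d) :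
    eval g (A ++ D ++ y :: x :: S) = eval g (A ++ D ++ x :: y :: S) := by
  have absorb_sq {C : List α} (hC : y ∈ C) : eval (g ^ 2) C * g y ^ 2 = eval (g ^ 2) C := by
    simpa only [eval_cons, eval_nil, mul_one, pow_two] using
      hN.eval_sq_mul_eval g (List.cons_subset.2 ⟨hC, List.cons_subset.2 ⟨hC, List.nil_subset C⟩⟩)
  have square {v : List α} (hv : v.Perm [y, x]) :
      eval g (A ++ (D ++ v) ++ S) = eval g A * eval (g ^ 2) (D ++ v) * eval g S := by
    refine hN.eval_eq_mul_eval_sq_mul g fun d hd => (hD d ?_).trans_eq ?_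
    · simpa only [List.mem_append, hv.mem_iff] using hd
    · simp only [List.count_append, hv.count_eq, List.count_cons, List.count_nil]
      omega
  have hsq : eval (g ^ 2) (D ++ [y, x]) = eval (g ^ 2) (D ++ [x, y]) :=
    calc eval (g ^ 2) (D ++ [y, x])
        = eval (g ^ 2) D * g y ^ 2 * g x ^ 2 := by
          simp only [eval_append, eval_cons, eval_nil, mul_one, Pi.pow_apply, mul_assoc]
      _ = eval (g ^ 2) (D ++ [x]) * g y ^ 2 := by
          rw [absorb_sq hy, absorb_sq (List.mem_append_left _ hy)]
          simp only [eval_append, eval_cons, eval_nil, mul_one, Pi.pow_apply]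
      _ = eval (g ^ 2) (D ++ [x, y]) := by
          simp only [eval_append, eval_cons, eval_nil, mul_one, Pi.pow_apply, mul_assoc]
  have hswap := (square (List.Perm.refl [y, x])).trans
    (hsq ▸ (square (List.Perm.swap y x [])).symm)
  simpa only [List.append_assoc, List.cons_append, List.nil_append] using hswap

end IsE1

end Swap

/-! ### Order-preserving alternations -/

theorem count_le_count_flatMap {α β : Type*} [DecidableEq α] [DecidableEq β] {φ : α → List β}
    {x : α} {c : β} (hx : φ x = [c]) (w : List α) : w.count x ≤ (w.flatMap φ).count c := by
  induction w with
  | nil => exact Nat.zero_le _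
  | cons l w ih =>
    rw [List.flatMap_cons, List.count_append]
    obtain rfl | hl := eq_or_ne l x
    · rw [hx, List.count_cons_self, List.count_singleton_self]
      omega
    · rw [List.count_cons_of_ne hl]
      omega

theorem flatMap_update_append_singleton {α β : Type*} [DecidableEq α] (φ : α → List β)
    {P : List α} {s : α} (hs : s ∉ P) (v : List β) :
    (P ++ [s]).flatMap (Function.update φ s v) = P.flatMap φ ++ v := by
  rw [List.flatMap_append, List.flatMap_singleton, Function.update_self,
    List.flatMap_congr fun l hl => Function.update_of_ne (ne_of_mem_of_not_mem hl hs) v φ]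

theorem eq_nil_of_mem_append_right {K : ℕ → Prop} {φ : ℕ → List ℕ} {z z' l : ℕ} {P T : List ℕ}
    (hφ : ∀ l, φ l ≠ [] → l = z ∨ l = z' ∨ l ∈ P ∧ ¬ K l)
    (hPT : ∀ l, ¬ K l → (P ++ T).count l ≤ 1) (hl : l ∈ T) (hlz : l ≠ z) (hlz' : l ≠ z') :
    φ l = [] := by
  by_contra hne
  obtain ⟨hlP, hlK⟩ := ((hφ l hne).resolve_left hlz).resolve_left hlz'
  have hle := hPT l hlK
  have hP := List.count_pos_iff.2 hlP
  have hT := List.count_pos_iff.2 hl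
  rw [List.count_append] at hle
  omega

theorem flatMap_append_append_cons {K : ℕ → Prop} {φ : ℕ → List ℕ} {x y c : ℕ} {P A B : List ℕ}
    (hφ : ∀ l, φ l ≠ [] → l = x ∨ l = y ∨ l ∈ P ∧ ¬ K l)
    (hP : ∀ l, ¬ K l → (P ++ (A ++ x :: B)).count l ≤ 1) (hx : φ x = [c]) (hxA : x ∉ A)
    (hyA : y ∉ A) :
    (P ++ (A ++ x :: B)).flatMap φ = P.flatMap φ ++ c :: B.flatMap φ := by
  have hA : A.flatMap φ = [] := List.flatMap_eq_nil_iff.2 fun l hl =>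
    eq_nil_of_mem_append_right hφ hP (List.mem_append_left _ hl) (ne_of_mem_of_not_mem hl hxA)
      (ne_of_mem_of_not_mem hl hyA)
  rw [List.flatMap_append, List.flatMap_append, List.flatMap_cons, hA, hx]
  rfl

theorem exists_run_append_flatMap_of_notMem {n e z z' : ℕ} {P : List ℕ} (hz : z ∉ P) (hz' : z' ∉ P)
    (hne : z ≠ z') (he : e ≤ n) :
    ∃ (L : List ℕ) (φ : ℕ → List ℕ), φ z = [blockLetter e] ∧ φ z' = [blockLetter (e + 1)] ∧
      (∀ l, φ l ≠ [] → l = z ∨ l = z') ∧ run (start n) (L ++ P.flatMap φ) = start e := by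
  obtain ⟨L, hL⟩ := exists_run_start_eq he
  refine ⟨L, fun l => if l = z then [blockLetter e] else if l = z' then [blockLetter (e + 1)]
    else [], if_pos rfl, by simp only [hne.symm, if_true, if_false], fun l hl => ?_, ?_⟩
  · by_contra! h
    exact hl (by simp only [h.1, h.2, if_false])
  · rw [List.flatMap_eq_nil_iff.2, List.append_nil, hL]
    intro l hl
    simp only [ne_of_mem_of_not_mem hl hz, ne_of_mem_of_not_mem hl hz', if_false]

theorem run_append_flatMap_update {e j s : ℕ} {q : State} {φ : ℕ → List ℕ} {L P Q : List ℕ}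
    (hrun : run q (L ++ P.flatMap φ) = start (e + 1))
    (hQ : Q.flatMap φ = List.replicate j (blockLetter e)) (hj : j ≠ 0) (hs : s ∉ P ++ Q) :
    run q (L ++ (P ++ Q ++ [s]).flatMap (Function.update φ s [e + 3])) = start e := by
  rw [flatMap_update_append_singleton φ hs, List.flatMap_append, hQ, ← List.append_assoc,
    ← List.append_assoc, run_append, run_append, hrun, start, run_block_replicate e false hj,
    run_cons, step_block_true, run_nil]

theorem Alternates.exists_subst {K : ℕ → Prop} {n d e z z' : ℕ} {P : List ℕ}
    (h : Alternates K d z z' P) (hz : K z) (hz' : K z') (hne : z ≠ z')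
    (hP : ∀ l, ¬ K l → P.count l ≤ 1) (he : e + d ≤ n) :
    ∃ (L : List ℕ) (φ : ℕ → List ℕ), φ z = [blockLetter e] ∧ φ z' = [blockLetter (e + 1)] ∧
      (∀ l, φ l ≠ [] → l = z ∨ l = z' ∨ l ∈ P ∧ ¬ K l) ∧
      run (start n) (L ++ P.flatMap φ) = start e := by
  induction h generalizing e with
  | nil hzP hz'P =>
    obtain ⟨L, φ, hφz, hφz', hφ, hrun⟩ := exists_run_append_flatMap_of_notMem hzP hz'P hne he
    exact ⟨L, φ, hφz, hφz', fun l hl => (hφ l hl).imp_right Or.inl, hrun⟩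
  | @step d z z' s P Q h hzQ hz'Q hs ih =>
    have hcount : ∀ l, ¬ K l → P.count l + Q.count l + [s].count l ≤ 1 := fun l hl => by
      simpa only [List.count_append] using hP l hl
    obtain ⟨L, φ, hφz, hφz', hφ, hrun⟩ := ih hz' hz hne.symm
      (fun l hl => by have := hcount l hl; omega) (e := e + 1) (by omega)
    have hs_notMem : s ∉ P ++ Q := by
      have := hcount s hs
      rw [List.count_singleton_self] at this
      rw [← List.count_eq_zero, List.count_append]
      omega
    rw [blockLetter_add_two] at hφz'
    have hφQ : Q.flatMap φ = List.replicate (Q.count z') (blockLetter e) := by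
      refine flatMap_eq_replicate hφz' fun l hl hlz' => ?_
      refine eq_nil_of_mem_append_right hφ (fun l hl => ?_) hl (ne_of_mem_of_not_mem hl hzQ) hlz'
      have := hcount l hl
      rw [List.count_append]
      omega
    have hupdate : ∀ l ≠ s, Function.update φ s [e + 3] l = φ l := fun l hl =>
      Function.update_of_ne hl _ φ
    refine ⟨L, Function.update φ s [e + 3], ?_, ?_, fun l hl => ?_, ?_⟩
    · rw [hupdate z' (by rintro rfl; exact hs hz), hφz']
    · rw [hupdate z (by rintro rfl; exact hs hz'), hφz]
    · obtain rfl | hls := eq_or_ne l s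
      · exact Or.inr (Or.inr ⟨by simp, hs⟩)
      · obtain rfl | rfl | ⟨hlP, hlK⟩ := hφ l (hupdate l hls ▸ hl)
        exacts [Or.inr (Or.inl rfl), Or.inl rfl, Or.inr (Or.inr ⟨by simp [hlP], hlK⟩)]
    · exact run_append_flatMap_update hrun hφQ (List.count_pos_iff.2 hz'Q).ne' hs_notMem

theorem append_zero_cons_notMem_vLanguage {n : ℕ} {L : List ℕ} (hL : run (start n) L = last)
    (W : List ℕ) : L ++ 0 :: W ∉ vLanguage n := by
  intro hmem
  have hdead : run (start n) (L ++ 0 :: W) = dead := by rw [run_append, hL]; exact run_dead W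
  exact absurd (hdead.symm.trans hmem.1) nofun

/-- Otherwise a substitution would map `P` to a word after which `b` has to be read, whereas the
images of `U` and `V` continue with `b` and `a`, respectively. -/
theorem SubstEquiv.not_alternates {n d z z' : ℕ} (hn : 1 ≤ n) {P A₁ A₂ B₁ B₂ U V : List ℕ}
    (h : SubstEquiv (vLanguage n) U V) {K : ℕ → Prop} (hK : ∀ l, K l ↔ 2 ≤ U.count l)
    (hU : U = P ++ (A₁ ++ z' :: A₂)) (hV : V = P ++ (B₁ ++ z :: B₂)) (hne : z ≠ z')
    (hz : K z) (hz' : K z')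
    (hzA₁ : z ∉ A₁) (hz'A₁ : z' ∉ A₁) (hzB₁ : z ∉ B₁) (hz'B₁ : z' ∉ B₁) (hzA₂ : z ∈ A₂)
    (hd : d ≤ n) : ¬ Alternates K d z z' P := by
  intro hP
  have hcountU : ∀ l, ¬ K l → U.count l ≤ 1 := fun l hl => by rw [hK] at hl; omega
  have hcountV : ∀ l, ¬ K l → V.count l ≤ 1 := fun l hl =>
    (h.count_eq hn (hcountU l hl)).trans_le (hcountU l hl)
  obtain ⟨L, φ, hφz, hφz', hφ, hrun⟩ := hP.exists_subst (n := n) (e := 0) hz hz' hne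
    (fun l hl => (hU ▸ List.sublist_append_left P _).count_le l |>.trans (hcountU l hl)) (by omega)
  have hUφ : L ++ U.flatMap φ = L ++ P.flatMap φ ++ 1 :: A₂.flatMap φ := by
    rw [hU, flatMap_append_append_cons (fun l hl => or_left_comm.1 (hφ l hl)) (hU ▸ hcountU) hφz'
      hz'A₁ hzA₁, List.append_assoc]
    rfl
  have hVφ : L ++ V.flatMap φ = L ++ P.flatMap φ ++ 0 :: B₂.flatMap φ := by
    rw [hV, flatMap_append_append_cons hφ (hV ▸ hcountV) hφz hzB₁ hz'B₁, List.append_assoc]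
    rfl
  have hA₂ : ∀ c ∈ A₂.flatMap φ, c ≤ 1 := fun c hc => by
    obtain ⟨l, hl, hc⟩ := List.mem_flatMap.1 hc
    have hφl := eq_nil_of_mem_append_right (T := A₁ ++ z' :: A₂) hφ (hU ▸ hcountU) (l := l)
      (List.mem_append_right _ (List.mem_cons_of_mem _ hl))
    by_cases hlz : l = z <;> by_cases hlz' : l = z' <;>
      simp_all [blockLetter_le_one]
  have hUmem : L ++ U.flatMap φ ∈ vLanguage n := by
    refine ⟨?_, ?_⟩
    · rw [hUφ, run_append, hrun]
      exact run_last_iff.2 ⟨_, rfl, hA₂, List.mem_flatMap.2 ⟨z, hzA₂, by simp [hφz]⟩⟩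
    · have : U.count z' ≤ (U.flatMap φ).count 1 := count_le_count_flatMap hφz' U
      have := (hK z').1 hz'
      rw [List.count_append]
      omega
  have hVmem := (h φ L []).1 ((List.append_nil _).symm ▸ hUmem)
  rw [List.append_nil, hVφ] at hVmem
  exact append_zero_cons_notMem_vLanguage hrun _ hVmem

/-! ### Identities of `𝔼¹{σ_{n+1}}` -/

theorem mem_ulift_E1sigma_iff {m : ℕ} {M : Type} [Monoid M] :
    (E1sigma.{u} m).Mem (ULift.{u} M) ↔ (E1sigma.{0} m).Mem M :=
  forall₂_congr fun _ _ => satisfies_ulift_iff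

theorem models_E1sigma_iff_eval {m : ℕ} {U V : List ℕ} :
    (E1sigma.{u} m).Models (ofList U) (ofList V) ↔ ∀ (N : Type u) [Monoid N], IsE1 N →
      Satisfies N (uWord m) (vWord m) → ∀ g : ℕ → N, eval g U = eval g V := by
  simp only [MonoidVariety.Models, mem_E1sigma_iff, and_imp]
  simp only [Satisfies, lift_eq_eval, FreeMonoid.toList_ofList]

theorem stable_betaClass_of_mem_MW {V : MonoidVariety.{u}} {w : Word}
    (h : V.Mem (ULift.{u} (MW beta (betaClass w)))) : V.Stable (betaClass w) :=
  MonoidVariety.stable_of_mem_MW (fun _ _ => mem_betaClass_of_beta) h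

theorem substEquiv_of_models_E1sigma {n : ℕ} (hn : 1 ≤ n) {U V : List ℕ}
    (h : (E1sigma.{u} (n + 1)).Models (ofList U) (ofList V)) : SubstEquiv (vLanguage n) U V := by
  rw [← ofList_preimage_betaClass_vWord hn]
  exact h.substEquiv (stable_betaClass_of_mem_MW (mem_ulift_E1sigma_iff.2 (mem_E1sigma_MW hn)))

theorem models_E1sigma_absorb {m : ℕ} {A D C B : List ℕ} (hC : C ⊆ D)
    (hD : ∀ d ∈ D, 2 ≤ (A ++ D ++ B).count d) :
    (E1sigma.{u} m).Models (ofList (A ++ D ++ C ++ B)) (ofList (A ++ D ++ B)) :=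
  models_E1sigma_iff_eval.2 fun _ _ hN _ g => hN.eval_absorb g hC hD

section Transform

variable {n x y s r : ℕ} {q D w w' v A B U V : List ℕ}

namespace SubstEquiv

theorem subset_of_gap (hn : 1 ≤ n) (h : SubstEquiv (vLanguage n) U V)
    (hU : U = q ++ s :: (D ++ w) ++ x :: A) (hV : V = q ++ s :: D ++ x :: B)
    (hs : U.count s = 1) (hx : U.count x = 1) : w ⊆ D := by
  intro y hy
  have hcount : U.count y = q.count y + (s :: D).count y + w.count y + (x :: A).count y := by
    rw [hU]; simp only [List.count_append, List.count_cons]; omega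
  have hyw := List.count_pos_iff.2 hy
  refine h.symm.mem_between hn hV hU ((h.count_eq hn hs.le).trans hs)
    ((h.count_eq hn hx.le).trans hx) ?_ ?_ (List.mem_append_right D hy)
  · rintro rfl
    rw [List.count_cons_self] at hcount
    omega
  · rintro rfl
    rw [List.count_cons_self] at hcount
    omega

theorem shareBlock_or_alternating (hn : 1 ≤ n) (h : SubstEquiv (vLanguage n) U V)
    (hU : U = q ++ [s] ++ (D ++ w ++ y :: A)) (hV : V = q ++ [s] ++ (D ++ x :: B))
    (hs : U.count s = 1) (hx : 2 ≤ U.count x) (hy : 2 ≤ U.count y) (hxD : x ∉ D) (hyD : y ∉ D)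
    (hxw : x ∉ w) (hyw : y ∉ w) (hxA : x ∈ A) (hyB : y ∈ B) (hne : x ≠ y) :
    ShareBlock (fun l => 2 ≤ U.count l) x y q ∨
      ∃ z z', s(z, z') = s(x, y) ∧ (alternating (n + 1) z z').Sublist (q ++ [s]) := by
  obtain hblock | ⟨d, z, z', hzz', hd⟩ := shareBlock_or_alternates (K := fun l => 2 ≤ U.count l)
    (T := []) (s := s) hx hy q (fun _ hl => absurd hl List.not_mem_nil) (by omega)
  · exact Or.inl (List.append_nil q ▸ hblock)
  rw [List.append_nil] at hd
  refine Or.inr ⟨z, z', hzz', ?_⟩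
  suffices n + 1 ≤ d from (alternating_sublist_alternating this z z').trans hd.alternating_sublist
  by_contra! hdn
  have hxDw : x ∉ D ++ w := by simp only [List.mem_append, hxD, hxw, or_false, not_false_eq_true]
  have hyDw : y ∉ D ++ w := by simp only [List.mem_append, hyD, hyw, or_false, not_false_eq_true]
  obtain ⟨rfl, rfl⟩ | ⟨rfl, rfl⟩ := Sym2.eq_iff.1 hzz'
  · exact h.not_alternates hn (fun _ => Iff.rfl) hU hV hne hx hy hxDw hyDw hxD hyD hxA
      (Nat.lt_succ_iff.1 hdn) hd
  · exact h.symm.not_alternates hn (fun _ => h.two_le_count_iff hn) hV hU hne.symm hy hx hyD hxD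
      hyDw hxDw hyB (Nat.lt_succ_iff.1 hdn) hd

theorem eval_swap (hn : 1 ≤ n) (h : SubstEquiv (vLanguage n) U V) {N : Type*} [Monoid N]
    (hN : IsE1 N) (hσ : Satisfies N (uWord (n + 1)) (vWord (n + 1))) (g : ℕ → N)
    (hU : U = q ++ s :: D ++ (w ++ y :: w') ++ x :: A) (hV : V = q ++ s :: D ++ x :: B)
    (hs : U.count s = 1) (hx : 2 ≤ U.count x) (hy : 2 ≤ U.count y)
    (hDw : ∀ d ∈ D ++ w, 2 ≤ U.count d) (hxD : x ∉ D) (hxw : x ∉ w) (hne : x ≠ y)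
    (hyB : y ∉ D → y ∈ B) :
    eval g (q ++ s :: D ++ w ++ y :: x :: (w' ++ A)) =
      eval g (q ++ s :: D ++ w ++ x :: y :: (w' ++ A)) := by
  have hcount : ∀ l, (q ++ s :: D ++ w ++ x :: y :: (w' ++ A)).count l = U.count l := fun l => by
    rw [hU]; simp only [List.count_append, List.count_cons]; omega
  have hperm : (q ++ s :: D ++ w ++ y :: x :: (w' ++ A)).Perm
      (q ++ s :: D ++ w ++ x :: y :: (w' ++ A)) := (List.Perm.swap ..).append_left _
  by_cases hyDw : y ∈ D ++ w
  · have hblock : q ++ s :: D ++ w = q ++ [s] ++ (D ++ w) := by simp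
    rw [hblock] at hcount hperm ⊢
    refine hN.eval_swap_of_mem hyDw fun d hd => ?_
    rw [hperm.count_eq, hcount]
    obtain hd | hd := List.mem_append.1 hd
    · exact hDw d hd
    · obtain rfl | rfl := List.mem_pair.1 hd
      exacts [hy, hx]
  have hyD : y ∉ D := fun hyD => hyDw (List.mem_append_left w hyD)
  have hyw : y ∉ w := fun hyw => hyDw (List.mem_append_right D hyw)
  obtain hblock | ⟨z, z', hzz', hz⟩ := h.shareBlock_or_alternating hn (q := q) (D := D) (w := w)
    (A := w' ++ x :: A) (B := B) (by simp [hU]) (by simp [hV]) hs hx hy hxD hyD hxw hyw (by simp)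
    (hyB hyD) hne
  · refine (hN.eval_swap_of_shareBlock hσ (fun l hl => (hcount l).symm ▸ hl) ?_).symm
    exact (hblock.append (s :: D)).append w
  have hsub : (alternating (n + 1) z z').Sublist (q ++ s :: D ++ w) := hz.trans <| by
    simp only [List.append_assoc, List.cons_append]
    exact (List.Sublist.refl q).append ((List.nil_sublist _).cons_cons s)
  obtain ⟨rfl, rfl⟩ | ⟨rfl, rfl⟩ := Sym2.eq_iff.1 hzz'
  · refine (hN.eval_swap_of_alternating hσ ?_ ?_ hsub).symm <;> rwa [hcount]
  · refine hN.eval_swap_of_alternating hσ ?_ ?_ hsub <;> rwa [hperm.count_eq, hcount]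

theorem two_le_count_of_notMem (hn : 1 ≤ n) (h : SubstEquiv (vLanguage n) U V)
    (hU : U = q ++ s :: D ++ (w ++ x :: A)) (hV : V = q ++ s :: D ++ x :: B)
    (hs : U.count s = 1) (hx : 2 ≤ U.count x) (hxD : x ∉ D) (hxw : x ∉ w) (hy : y ∈ w) :
    2 ≤ U.count y := by
  by_contra! hcount
  have hcountV := h.count_eq hn (Nat.lt_succ_iff.1 hcount)
  obtain ⟨w₁, w₂, rfl⟩ := List.append_of_mem hy
  have hyx : y ≠ x := by rintro rfl; exact hxw hy
  have hyB : y ∈ B := by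
    rw [hU, hV] at hcountV
    simp only [List.count_append, List.count_cons, beq_self_eq_true, if_true, hyx.symm,
      beq_iff_eq, if_false] at hcountV
    exact List.count_pos_iff.1 (by omega)
  obtain ⟨B₁, B₂, rfl⟩ := List.append_of_mem hyB
  have hy1 : U.count y = 1 :=
    (Nat.lt_succ_iff.1 hcount).antisymm (List.count_pos_iff.2 (by simp [hU]))
  have hxs : x ≠ s := by rintro rfl; omega
  have := h.mem_between hn (x := x) (U₂ := D ++ w₁) (V₂ := D ++ x :: B₁) (U₁ := q) (V₁ := q)
    (U₃ := w₂ ++ x :: A) (V₃ := B₂) (by simp [hU]) (by simp [hV]) hs hy1 hxs hyx.symm (by simp)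
  exact (List.mem_append.1 this).elim hxD fun hx => hxw (List.mem_append_left _ hx)

theorem mem_of_mem_gap (hn : 1 ≤ n) (h : SubstEquiv (vLanguage n) U V)
    (hU : U = q ++ s :: D ++ v ++ [r]) (hV : V = q ++ s :: D ++ w ++ [r]) (hs : U.count s = 1)
    (hr : U.count r = 1) (hx : 2 ≤ U.count x) (hxw : x ∈ w) (hxD : x ∉ D) : x ∈ v := by
  have hxDv := h.mem_between hn (x := x) (U₁ := q) (U₂ := D ++ v) (U₃ := []) (V₁ := q)
    (V₂ := D ++ w) (V₃ := []) (by simp [hU]) (by simp [hV]) hs hr (by rintro rfl; omega)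
    (by rintro rfl; omega) (List.mem_append_right D hxw)
  exact (List.mem_append.1 hxDv).resolve_left hxD

theorem exists_models_cons (hn : 1 ≤ n) (h : SubstEquiv (vLanguage n) U V)
    (hU : U = q ++ s :: D ++ v ++ [r]) (hV : V = q ++ s :: D ++ x :: w ++ [r])
    (hs : U.count s = 1) (hr : U.count r = 1) (hD : ∀ d ∈ D, 2 ≤ U.count d)
    (hx : 2 ≤ U.count x) :
    ∃ v', (E1sigma.{u} (n + 1)).Models (ofList U) (ofList (q ++ s :: D ++ x :: v' ++ [r])) := by
  by_cases hxD : x ∈ D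
  · have := models_E1sigma_absorb.{u} (m := n + 1) (A := q ++ [s]) (B := v ++ [r])
      (List.cons_subset.2 ⟨hxD, List.nil_subset D⟩) (by simpa [hU] using hD)
    exact ⟨v, by simpa [hU] using this.symm⟩
  have hxv : x ∈ v := h.mem_of_mem_gap hn hU hV hs hr hx List.mem_cons_self hxD
  obtain ⟨v₁, v₂, rfl, hxv₁⟩ := List.eq_append_cons_of_mem hxv
  have hv₁ : ∀ y ∈ v₁, 2 ≤ U.count y := fun y hy =>
    h.two_le_count_of_notMem hn (q := q) (D := D) (A := v₂ ++ [r]) (B := w ++ [r]) (by simp [hU])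
      (by simp [hV]) hs hx hxD hxv₁ hy
  refine ⟨v₁ ++ v₂, models_E1sigma_iff_eval.2 fun N _ hN hσ g => ?_⟩
  have hmove := eq_of_forall_swap (P := q ++ s :: D) (x := x) (S := v₂ ++ [r]) (eval g) (w := v₁) ?_
  · simpa [hU] using hmove
  rintro w₁ y w₂ rfl
  have hxy : x ≠ y ∧ x ∉ w₁ := by
    simp only [List.mem_append, List.mem_cons, not_or] at hxv₁
    exact ⟨hxv₁.2.1, hxv₁.1⟩
  have hy := hv₁ y (by simp)
  refine h.eval_swap hn hN hσ g (A := v₂ ++ [r]) (B := w ++ [r]) (by simp [hU]) (by simp [hV]) hs hx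
    hy ?_ hxD hxy.2 hxy.1 fun hyD => ?_
  · exact fun d hd => (List.mem_append.1 hd).elim (hD d) fun hd => hv₁ d (by simp [hd])
  · have hyw := h.symm.mem_of_mem_gap hn hV hU ((h.count_eq hn hs.le).trans hs)
      ((h.count_eq hn hr.le).trans hr) ((h.two_le_count_iff hn).1 hy) (by simp) hyD
    exact List.mem_append_left _ ((List.mem_cons.1 hyw).resolve_left hxy.1.symm)

theorem exists_models_gap (hn : 1 ≤ n) (h : SubstEquiv (vLanguage n) U V)
    (hU : U = q ++ s :: D ++ v ++ [r]) (hV : V = q ++ s :: D ++ x :: w ++ [r])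
    (hs : U.count s = 1) (hD : ∀ d ∈ D, 2 ≤ U.count d) (hx : U.count x = 1) :
    ∃ v₁ v₂, v = v₁ ++ x :: v₂ ∧ (E1sigma.{u} (n + 1)).Models (ofList V)
      (ofList (q ++ s :: D ++ v₁ ++ x :: w ++ [r])) := by
  have hxv : x ∈ v := by
    have hxV := (h.count_eq hn hx.le).trans hx
    rw [hU] at hx
    rw [hV] at hxV
    simp only [List.count_append, List.count_cons_self] at hx hxV
    exact List.count_pos_iff.1 (by omega)
  obtain ⟨v₁, v₂, rfl⟩ := List.append_of_mem hxv
  have hv₁ : v₁ ⊆ D := h.subset_of_gap hn (q := q) (A := v₂ ++ [r]) (B := w ++ [r]) (by simp [hU])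
    (by simp [hV]) hs hx
  have := models_E1sigma_absorb.{u} (m := n + 1) (A := q ++ [s]) (B := x :: w ++ [r]) hv₁
    fun d hd => by simpa [hV] using (h.two_le_count_iff hn).1 (hD d hd)
  exact ⟨v₁, v₂, rfl, by simpa [hV] using this.symm⟩

/-- The common part `q s D` is extended by the next letter `x` of `V`: a multiple `x` is moved there
in `U`, and if `x` is simple, the letters before it in `U` all occur in `D` and are inserted in
`V`. -/
theorem models_of_eq_append (hn : 1 ≤ n) (h : SubstEquiv (vLanguage n) U V)
    (hU : U = q ++ s :: D ++ v ++ [r]) (hV : V = q ++ s :: D ++ w ++ [r])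
    (hs : U.count s = 1) (hr : U.count r = 1) (hD : ∀ d ∈ D, 2 ≤ U.count d) :
    (E1sigma.{u} (n + 1)).Models (ofList U) (ofList V) := by
  induction w generalizing q s D v U V with
  | nil =>
    have hvD : v ⊆ D := h.subset_of_gap hn (q := q) (A := []) (B := []) (by simp [hU])
      (by simp [hV]) hs hr
    have := models_E1sigma_absorb.{u} (m := n + 1) (A := q ++ [s]) (B := [r]) hvD fun d hd => by
      simpa [hV] using (h.two_le_count_iff hn).1 (hD d hd)
    simpa [hU, hV] using this
  | cons x w ih =>
    obtain hx | hx := le_or_gt 2 (U.count x)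
    · obtain ⟨v', hv'⟩ := h.exists_models_cons.{u} hn hU hV hs hr hD hx
      have hUU' := substEquiv_of_models_E1sigma hn hv'
      have hD' : ∀ d ∈ D ++ [x], 2 ≤ U.count d := fun d hd =>
        (List.mem_append.1 hd).elim (hD d) fun hd => List.mem_singleton.1 hd ▸ hx
      refine (E1sigma (n + 1)).congruence.trans hv' (ih (hUU'.symm.trans h) (q := q) (s := s)
        (D := D ++ [x]) (v := v') (by simp) (by simp [hV]) ?_ ?_ fun d hd => ?_)
      · rw [hUU'.count_eq hn hs.le, hs]
      · rw [hUU'.count_eq hn hr.le, hr]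
      · exact (hUU'.two_le_count_iff hn).1 (hD' d hd)
    · have hx1 : U.count x = 1 := by
        have hxV : 0 < V.count x := List.count_pos_iff.2 (by simp [hV])
        have := h.count_eq hn (x := x) (by omega)
        omega
      obtain ⟨v₁, v₂, rfl, hV'⟩ := h.exists_models_gap.{u} hn hU hV hs hD hx1
      refine (E1sigma (n + 1)).congruence.trans (ih (h.trans (substEquiv_of_models_E1sigma hn hV'))
        (q := q ++ s :: D ++ v₁) (s := x) (D := []) (v := v₂) (by simp [hU]) (by simp) hx1 hr
        (by simp)) hV'.symm

end SubstEquiv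

theorem models_E1sigma_of_substEquiv (hn : 1 ≤ n) (h : SubstEquiv (vLanguage n) U V) :
    (E1sigma.{u} (n + 1)).Models (ofList U) (ofList V) := by
  obtain ⟨s, hs⟩ := (U ++ V).toFinset.exists_notMem
  obtain ⟨r, hr⟩ := (s :: (U ++ V)).toFinset.exists_notMem
  simp only [List.mem_toFinset, List.mem_cons, List.mem_append, not_or] at hs hr
  have hsr : s ≠ r := Ne.symm hr.1
  have hmodels := (h.append_append [s] [r]).models_of_eq_append.{u} hn (q := []) (s := s)
    (D := []) (v := U) (w := V) (r := r) (by simp) (by simp)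
    (by simp [List.count_eq_zero_of_not_mem hs.1, hsr.symm])
    (by simp [List.count_eq_zero_of_not_mem hr.2.1, hsr]) (by simp)
  refine models_E1sigma_iff_eval.2 fun N _ hN hσ g => ?_
  let g' : ℕ → N := Function.update (Function.update g r 1) s 1
  have hg's : g' s = 1 := Function.update_self ..
  have hg'r : g' r = 1 := by simp only [g', Function.update_of_ne hsr.symm, Function.update_self]
  have hg' {X : List ℕ} (hsX : s ∉ X) (hrX : r ∉ X) : eval g' ([s] ++ X ++ [r]) = eval g X := by
    have : eval g' X = eval g X := congr_arg List.prod <| List.map_congr_left fun l hl => by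
      simp only [g', Function.update_of_ne (ne_of_mem_of_not_mem hl hsX),
        Function.update_of_ne (ne_of_mem_of_not_mem hl hrX)]
    simp only [eval_append, eval_cons, eval_nil, hg's, hg'r, this, one_mul, mul_one]
  rw [← hg' hs.1 hr.2.1, ← hg' hs.2 hr.2.2]
  exact models_E1sigma_iff_eval.1 hmodels N hN hσ g'

end Transform

theorem E1sigma_eq_varMW {n : ℕ} (hn : 1 ≤ n) :
    E1sigma.{u} (n + 1) = varMW.{u} beta (betaClass (vWord n)) :=
  MonoidVariety.eq_generatedBy (mem_ulift_E1sigma_iff.2 (mem_E1sigma_MW hn)) fun _ _ h =>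
    models_E1sigma_of_substEquiv hn <| ofList_preimage_betaClass_vWord hn ▸
      Satisfies.substEquiv (fun _ _ => mem_betaClass_of_beta) (satisfies_ulift_iff.1 h)

theorem E1sigma_le_iff_stable {n : ℕ} (hn : 1 ≤ n) (V : MonoidVariety.{u}) :
    E1sigma.{u} (n + 1) ≤ V ↔ V.Stable (betaClass (vWord n)) := by
  refine ⟨fun h => stable_betaClass_of_mem_MW
    (h _ (mem_ulift_E1sigma_iff.2 (mem_E1sigma_MW hn))), fun h N _ hN => ?_⟩
  exact MonoidVariety.mem_iff_models.2 fun _ _ hpq => models_E1sigma_of_substEquiv hn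
    (ofList_preimage_betaClass_vWord hn ▸ hpq.substEquiv h) N hN

theorem a_mul_t_mul_b_sq_mul_a_mem_betaClass :
    a * t 1 * b ^ 2 * a ∈ betaClass (vWord 1) :=
  (mem_betaClass_vWord_iff le_rfl _).2 ⟨rfl, le_rfl⟩

end MonVar

theorem mainTheorem5 :
    (∀ n : ℕ, 1 ≤ n →
      MonVar.E1sigma.{u} (n + 1) = MonVar.varMW.{u} MonVar.beta (MonVar.betaClass (MonVar.vWord n))) ∧
    MonVar.E1sigma.{u} 2 =
      MonVar.varMW.{u} MonVar.beta
        (MonVar.betaClass (MonVar.a * MonVar.t 1 * MonVar.b ^ 2 * MonVar.a)) ∧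
    (∀ n : ℕ, 1 ≤ n → ∀ V : MonVar.MonoidVariety.{u},
      MonVar.E1sigma.{u} (n + 1) ≤ V ↔ V.Stable (MonVar.betaClass (MonVar.vWord n))) := by
  refine ⟨fun n hn => MonVar.E1sigma_eq_varMW hn, ?_,
    fun n hn V => MonVar.E1sigma_le_iff_stable hn V⟩
  rw [MonVar.betaClass_eq_of_mem MonVar.a_mul_t_mul_b_sq_mul_a_mem_betaClass]
  exact MonVar.E1sigma_eq_varMW le_rfl
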